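/- **Setting.** Let $N$, $K$, $N_B$ be the numbers of RIS elements, users and receive antennas. Given are channels $\boldsymbol h_k\in\mathbb C^N$, $\boldsymbol G_B\in\mathbb C^{N_B\times N}$, the mean $\hat{\boldsymbol g}\in\mathbb C^N$ of the RIS–eavesdropper channel, receive filters $\boldsymbol c_k\in\mathbb C^{N_B}$, transmit powers $p_k\ge 0$, weights $\mu_k\ge 0$, noise variances $\sigma_B^2,\sigma_{RIS}^2,\sigma_E^2>0$, a channel error variance $\sigma_g^2\ge 0$, the amplifier power $P_{R,max}>0$, and static powers with $P_c=NP_{c,n}+P_{0,RIS}+P_0>0$. Put $\boldsymbol H_k=\mathrm{diag}(\boldsymbol h_k)$, $\boldsymbol A_k=\boldsymbol G_B\boldsymbol H_k$, $\boldsymbol R=\sum_kp_k\boldsymbol H_k^H\boldsymbol H_k+\sigma_{RIS}^2\boldsymbol I$, $\boldsymbol R_E=\hat{\boldsymbol g}\hat{\boldsymbol g}^H+\sigma_g^2\boldsymbol I$, $P_{c,eq}=\sum_k\mu_kp_k+P_c-\mathrm{tr}\boldsymbol R$ and, for $\boldsymbol\gamma\in\mathbb C^N$ with $\boldsymbol\Gamma=\mathrm{diag}(\boldsymbol\gamma)$,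 $\boldsymbol W=\sigma_B^2\boldsymbol I+\sigma_{RIS}^2\boldsymbol G_B\boldsymbol\Gamma\boldsymbol\Gamma^H\boldsymbol G_B^H$. Let $$\mathrm{SINR}_{k,B}=\frac{p_k|\boldsymbol c_k^H\boldsymbol A_k\boldsymbol\gamma|^2}{\boldsymbol c_k^H\boldsymbol W\boldsymbol c_k+\sum_{m\ne k}p_m|\boldsymbol c_k^H\boldsymbol A_m\boldsymbol\gamma|^2},\qquad \widetilde{\mathrm{SINR}}_{k,E}=\frac{p_k\|\boldsymbol R_E^{1/2}\boldsymbol H_k\boldsymbol\gamma\|^2}{\sum_{m\ne k}p_m\|\boldsymbol R_E^{1/2}\boldsymbol H_m\boldsymbol\gamma\|^2+\sigma_{RIS}^2\|\boldsymbol R_E^{1/2}\boldsymbol\gamma\|^2+\sigma_E^2}$$ ($\mathrm{SINR}_{k,B}=0$ if $\boldsymbol c_k=0$). The $\boldsymbol\gamma$-subproblem is $$\max_{\boldsymbol\gamma}\ \widetilde{\mathrm{SEE}}(\boldsymbol\gamma)=\frac{\sum_k\log_2(1+\mathrm{SINR}_{k,B})-\log_2(1+\widetilde{\mathrm{SINR}}_{k,E})}{\mathrm{tr}(\boldsymbol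 R\boldsymbol\gamma\boldsymbol\gamma^H)+P_{c,eq}}\quad\text{s.t.}\quad \mathrm{tr}\boldsymbol R\le\mathrm{tr}(\boldsymbol R\boldsymbol\gamma\boldsymbol\gamma^H)\le P_{R,max}+\mathrm{tr}\boldsymbol R .\qquad(1)$$ **Surrogate problem.** Let $\widetilde{\boldsymbol U}_k=\mathrm{diag}(|u_1|^2,\dots,|u_N|^2)$ with $\boldsymbol u=\boldsymbol G_B^H\boldsymbol c_k$, and $x_B=p_k|\boldsymbol c_k^H\boldsymbol A_k\boldsymbol\gamma|^2$, $y_B=\sigma_B^2\|\boldsymbol c_k\|^2+\sigma_{RIS}^2\|\widetilde{\boldsymbol U}_k^{1/2}\boldsymbol\gamma\|^2+\sum_{m\ne k}p_m|\boldsymbol c_k^H\boldsymbol A_m\boldsymbol\gamma|^2$, $x_E=p_k\|\boldsymbol R_E^{1/2}\boldsymbol H_k\boldsymbol\gamma\|^2$, $y_E=\sum_{m\ne k}p_m\|\boldsymbol R_E^{1/2}\boldsymbol H_m\boldsymbol\gamma\|^2+\sigma_{RIS}^2\|\boldsymbol R_E^{1/2}\boldsymbol\gamma\|^2$; a bar denotes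 the value at $\bar{\boldsymbol\gamma}$. Let $\boldsymbol M_{k,B}=\boldsymbol A_k^H\boldsymbol c_k\boldsymbol c_k^H\boldsymbol A_k$, $\boldsymbol M_{k,E}=\sum_{m\ne k}p_m\boldsymbol H_m^H\boldsymbol R_E\boldsymbol H_m+\sigma_{RIS}^2\boldsymbol R_E$, and let $$\tilde x_B=\sqrt{p_k}\Big(\sqrt{\bar{\boldsymbol\gamma}^H\boldsymbol M_{k,B}\bar{\boldsymbol\gamma}}+\tfrac{\Re(\bar{\boldsymbol\gamma}^H\boldsymbol M_{k,B}(\boldsymbol\gamma-\bar{\boldsymbol\gamma}))}{\sqrt{\bar{\boldsymbol\gamma}^H\boldsymbol M_{k,B}\bar{\boldsymbol\gamma}}}\Big),\qquad \tilde y_E=\sqrt{\bar{\boldsymbol\gamma}^H\boldsymbol M_{k,E}\bar{\boldsymbol\gamma}}+\tfrac{\Re(\bar{\boldsymbol\gamma}^H\boldsymbol M_{k,E}(\boldsymbol\gamma-\bar{\boldsymbol\gamma}))}{\sqrt{\bar{\boldsymbol\gamma}^H\boldsymbol M_{k,E}\bar{\boldsymbol\gamma}}}$$ be the first-order Taylor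 expansions of $\sqrt{x_B}$ and $\sqrt{y_E}$ at $\bar{\boldsymbol\gamma}$, and $$\begin{aligned}\widetilde R_{s,k}=&\log_2\!\Big(1+\tfrac{\bar x_B}{\bar y_B}\Big)+\tfrac1{\ln2}\tfrac{\bar x_B}{\bar y_B}\Big(\tfrac{2\tilde x_B}{\sqrt{\bar x_B}}-\tfrac{x_B+y_B}{\bar x_B+\bar y_B}-1\Big)+\log_2\!\Big(1+\tfrac{\bar y_E}{\sigma_E^2}\Big)+\tfrac1{\ln2}\tfrac{\bar y_E}{\sigma_E^2}\Big(\tfrac{2\tilde y_E}{\sqrt{\bar y_E}}-\tfrac{y_E+\sigma_E^2}{\bar y_E+\sigma_E^2}-1\Big)\\&+\log_2\!\Big(\tfrac{\sigma_E^2}{\sigma_E^2+\bar x_E+\bar y_E}\Big)-\tfrac1{\ln2}\tfrac{x_E+y_E-\bar x_E-\bar y_E}{\sigma_E^2+\bar x_E+\bar y_E},\end{aligned}$$ where the second (fourth) summand is $0$ if $\bar x_B=0$ (if $\bar y_E=0$), and $\log_2(1+\bar x_B/\bar y_B)$ is read as $0$ if $\boldsymbol c_k=0$. The surrogate problem at $\bar{\boldsymbol\gamma}$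 is to maximize $\sum_k\widetilde R_{s,k}/(\mathrm{tr}(\boldsymbol R\boldsymbol\gamma\boldsymbol\gamma^H)+P_{c,eq})$ subject to $\boldsymbol\gamma^H\boldsymbol R\boldsymbol\gamma\le P_{R,max}+\mathrm{tr}\boldsymbol R$ and $\bar{\boldsymbol\gamma}^H\boldsymbol R\bar{\boldsymbol\gamma}+2\Re\{\bar{\boldsymbol\gamma}^H\boldsymbol R(\boldsymbol\gamma-\bar{\boldsymbol\gamma})\}\ge\mathrm{tr}\boldsymbol R$. **Algorithm.** Start from any $\boldsymbol\gamma_0$ feasible for (1); let $\boldsymbol\gamma_{t+1}$ be any global solution of the surrogate problem at $\bar{\boldsymbol\gamma}=\boldsymbol\gamma_t$; stop when $|\widetilde{\mathrm{SEE}}(\boldsymbol\gamma_{t+1})-\widetilde{\mathrm{SEE}}(\boldsymbol\gamma_t)|<\epsilon$. **Proposition.** At every $\bar{\boldsymbol\gamma}$ feasible for (1) the surrogate problem has a solution, and all its solutions are feasible for (1). For every sequence $(\boldsymbol\gamma_t)$ generated by the algorithm (run indefinitely): 1. $\widetilde{\mathrm{SEE}}(\boldsymbol\gamma_t)$ is non-decreasing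 in $t$, and $\widetilde{\mathrm{SEE}}(\boldsymbol\gamma_t)<\widetilde{\mathrm{SEE}}(\boldsymbol\gamma_{t+1})$ unless $\boldsymbol\gamma_t$ is a KKT point of (1). 2. For every $\epsilon>0$ the stopping rule is met after finitely many iterations. 3. $\widetilde{\mathrm{SEE}}(\boldsymbol\gamma_t)$ converges to some $L\in\mathbb R$; the sequence $(\boldsymbol\gamma_t)$ has limit points, each of them is a KKT point of (1) with objective value $L$, and the distance from $\boldsymbol\gamma_t$ to the set of KKT points of (1) with objective value $L$ tends to $0$. 4. If $K\ge1$ and $\sigma_g^2>0$, then moreover $\|\boldsymbol\gamma_{t+1}-\boldsymbol\gamma_t\|\to0$. (KKT conditions are those of (1) as a problem in the real and imaginary parts of $\boldsymbol\gamma$.) -/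

import Mathlib

open scoped Matrix

noncomputable section

/-- `x` is a Karush-Kuhn-Tucker point of the problem `max f` subject to `g i ≤ 0` for all `i`. -/
def IsKKTPoint {E ι : Type*} [NormedAddCommGroup E] [NormedSpace ℝ E] [Fintype ι]
    (f : E → ℝ) (g : ι → E → ℝ) (x : E) : Prop :=
  DifferentiableAt ℝ f x ∧ (∀ i, DifferentiableAt ℝ (g i) x) ∧
  (∀ i, g i x ≤ 0) ∧
  ∃ l : ι → ℝ, (∀ i, 0 ≤ l i) ∧ (∀ i, l i * g i x = 0) ∧
    fderiv ℝ f x = ∑ i, l i • fderiv ℝ (g i) x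

/-- The quadratic form `vᴴ M v`, as a real number. For `M` positive semidefinite it is
`‖M^{1/2} v‖²`. -/
def quadForm {n : ℕ} (M : Matrix (Fin n) (Fin n) ℂ) (v : Fin n → ℂ) : ℝ :=
  (star v ⬝ᵥ (M *ᵥ v)).re

/-- The data of the uplink with `N` RIS elements, `K` users and `NB` receive antennas
(everything but the RIS vector, which is the optimisation variable). -/
structure RISNetwork (N K NB : ℕ) where
  /-- channels from the users to the RIS -/
  h : Fin K → Fin N → ℂ
  /-- channel from the RIS to the legitimate receiver -/
  GB : Matrix (Fin NB) (Fin N) ℂ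
  /-- mean of the channel from the RIS to the eavesdropper -/
  gHat : Fin N → ℂ
  /-- receive filters -/
  c : Fin K → Fin NB → ℂ
  /-- transmit powers -/
  p : Fin K → ℝ
  /-- transmit power weights (inverse amplifier efficiencies) -/
  μ : Fin K → ℝ
  /-- noise variance at the legitimate receiver -/
  varB : ℝ
  /-- noise variance at the active RIS -/
  varRIS : ℝ
  /-- noise variance at the eavesdropper -/
  varE : ℝ
  /-- variance of the error on the channel to the eavesdropper -/
  varG : ℝ
  /-- maximum radio-frequency power provided by the RIS amplifier -/
  PRmax : ℝ
  /-- static power per RIS element -/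
  Pcn : ℝ
  /-- remaining static power of the RIS -/
  P0RIS : ℝ
  /-- static power of the transmitters and of the legitimate receiver -/
  P0 : ℝ

namespace RISNetwork

variable {N K NB : ℕ} (S : RISNetwork N K NB)

/-- `H_k = diag(h_k)`. -/
def H (k : Fin K) : Matrix (Fin N) (Fin N) ℂ := Matrix.diagonal (S.h k)

/-- `A_k = G_B H_k`. -/
def A (k : Fin K) : Matrix (Fin NB) (Fin N) ℂ := S.GB * S.H k

/-- `R = ∑ k, p_k H_kᴴ H_k + σ_RIS² I`. -/
def R : Matrix (Fin N) (Fin N) ℂ :=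
  ∑ k, (S.p k : ℂ) • ((S.H k)ᴴ * S.H k) + (S.varRIS : ℂ) • 1

/-- `W = σ_B² I + σ_RIS² G_B Γ Γᴴ G_Bᴴ`, with `Γ = diag(γ)`. -/
def W (γ : Fin N → ℂ) : Matrix (Fin NB) (Fin NB) ℂ :=
  (S.varB : ℂ) • 1 +
    (S.varRIS : ℂ) • (S.GB * Matrix.diagonal γ * (Matrix.diagonal γ)ᴴ * S.GBᴴ)

/-- `R_E = ĝ ĝᴴ + σ_g² I`. -/
def RE : Matrix (Fin N) (Fin N) ℂ :=
  Matrix.vecMulVec S.gHat (star S.gHat) + (S.varG : ℂ) • 1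

/-- `tr R`. -/
def trR : ℝ := (S.R.trace).re

/-- `tr (R γ γᴴ)`. -/
def risPower (γ : Fin N → ℂ) : ℝ := (S.R * Matrix.vecMulVec γ (star γ)).trace.re

/-- `P_c = N P_{c,n} + P_{0,RIS} + P_0`. -/
def Pc : ℝ := N * S.Pcn + S.P0RIS + S.P0

/-- `P_{c,eq} = ∑ k, μ_k p_k + P_c - tr R`. -/
def Pceq : ℝ := ∑ k, S.μ k * S.p k + S.Pc - S.trR

/-- The SINR of user `k` at the legitimate receiver. -/
def sinrB (k : Fin K) (γ : Fin N → ℂ) : ℝ :=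
  S.p k * ‖star (S.c k) ⬝ᵥ (S.A k *ᵥ γ)‖ ^ 2 /
    (quadForm (S.W γ) (S.c k) +
      ∑ m ∈ Finset.univ.erase k, S.p m * ‖star (S.c k) ⬝ᵥ (S.A m *ᵥ γ)‖ ^ 2)

/-- The approximate SINR of user `k` at the eavesdropper, built from `R_E`. -/
def sinrE (k : Fin K) (γ : Fin N → ℂ) : ℝ :=
  S.p k * quadForm S.RE (S.H k *ᵥ γ) /
    (∑ m ∈ Finset.univ.erase k, S.p m * quadForm S.RE (S.H m *ᵥ γ) +
      S.varRIS * quadForm S.RE γ + S.varE)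

/-- The approximate secrecy energy efficiency as a function of the RIS vector. -/
def objective (γ : Fin N → ℂ) : ℝ :=
  (∑ k, (Real.logb 2 (1 + S.sinrB k γ) - Real.logb 2 (1 + S.sinrE k γ))) /
    (S.risPower γ + S.Pceq)

/-- The constraints `tr R ≤ tr (R γ γᴴ) ≤ P_{R,max} + tr R`, each written as `g i γ ≤ 0`. -/
def constraint (i : Fin 2) (γ : Fin N → ℂ) : ℝ :=
  ![S.trR - S.risPower γ, S.risPower γ - (S.PRmax + S.trR)] i

/-- The feasible set of the RIS subproblem. -/
def feasibleSet : Set (Fin N → ℂ) :=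
  {γ | S.trR ≤ S.risPower γ ∧ S.risPower γ ≤ S.PRmax + S.trR}

/-- KKT points of the RIS subproblem. -/
def IsKKT (γ : Fin N → ℂ) : Prop := IsKKTPoint S.objective S.constraint γ

/-- `x_B = p_k |c_kᴴ A_k γ|²`. -/
def xB (k : Fin K) (γ : Fin N → ℂ) : ℝ :=
  S.p k * ‖star (S.c k) ⬝ᵥ (S.A k *ᵥ γ)‖ ^ 2

/-- `Ũ_k = diag(|u_1|², …, |u_N|²)` with `u = G_Bᴴ c_k`. -/
def U (k : Fin K) : Matrix (Fin N) (Fin N) ℂ :=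
  Matrix.diagonal fun n => ((‖(S.GBᴴ *ᵥ S.c k) n‖ ^ 2 : ℝ) : ℂ)

/-- `y_B = σ_B² ‖c_k‖² + σ_RIS² ‖Ũ_k^{1/2} γ‖² + ∑_{m ≠ k} p_m |c_kᴴ A_m γ|²`. -/
def yB (k : Fin K) (γ : Fin N → ℂ) : ℝ :=
  S.varB * ∑ j, ‖S.c k j‖ ^ 2 + S.varRIS * quadForm (S.U k) γ +
    ∑ m ∈ Finset.univ.erase k, S.p m * ‖star (S.c k) ⬝ᵥ (S.A m *ᵥ γ)‖ ^ 2

/-- `x_E = p_k ‖R_E^{1/2} H_k γ‖²`. -/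
def xE (k : Fin K) (γ : Fin N → ℂ) : ℝ := S.p k * quadForm S.RE (S.H k *ᵥ γ)

/-- `y_E = ∑_{m ≠ k} p_m ‖R_E^{1/2} H_m γ‖² + σ_RIS² ‖R_E^{1/2} γ‖²`. -/
def yE (k : Fin K) (γ : Fin N → ℂ) : ℝ :=
  ∑ m ∈ Finset.univ.erase k, S.p m * quadForm S.RE (S.H m *ᵥ γ) +
    S.varRIS * quadForm S.RE γ

/-- `M_{k,B} = A_kᴴ c_k c_kᴴ A_k`. -/
def MB (k : Fin K) : Matrix (Fin N) (Fin N) ℂ :=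
  (S.A k)ᴴ * Matrix.vecMulVec (S.c k) (star (S.c k)) * S.A k

/-- `M_{k,E} = ∑_{m ≠ k} p_m H_mᴴ R_E H_m + σ_RIS² R_E`. -/
def ME (k : Fin K) : Matrix (Fin N) (Fin N) ℂ :=
  ∑ m ∈ Finset.univ.erase k, (S.p m : ℂ) • ((S.H m)ᴴ * S.RE * S.H m) +
    (S.varRIS : ℂ) • S.RE

/-- First-order Taylor expansion of `γ ↦ √(γᴴ M γ)` around `γ₀`. -/
def sqrtTaylor (M : Matrix (Fin N) (Fin N) ℂ) (γ₀ γ : Fin N → ℂ) : ℝ :=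
  √(quadForm M γ₀) + (star γ₀ ⬝ᵥ (M *ᵥ (γ - γ₀))).re / √(quadForm M γ₀)

/-- The linear lower bound of `√x_B`. -/
def xTildeB (k : Fin K) (γ₀ γ : Fin N → ℂ) : ℝ :=
  √(S.p k) * sqrtTaylor (S.MB k) γ₀ γ

/-- The linear lower bound of `√y_E`. -/
def yTildeE (k : Fin K) (γ₀ γ : Fin N → ℂ) : ℝ := sqrtTaylor (S.ME k) γ₀ γ

/-- The concave lower bound of the `k`-th secrecy rate built at `γ₀`. -/
def rateSurrogate (k : Fin K) (γ₀ γ : Fin N → ℂ) : ℝ :=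
  Real.logb 2 (1 + S.xB k γ₀ / S.yB k γ₀) +
  1 / Real.log 2 * (S.xB k γ₀ / S.yB k γ₀ *
    (2 * S.xTildeB k γ₀ γ / √(S.xB k γ₀)
      - (S.xB k γ + S.yB k γ) / (S.xB k γ₀ + S.yB k γ₀) - 1)) +
  Real.logb 2 (1 + S.yE k γ₀ / S.varE) +
  1 / Real.log 2 * (S.yE k γ₀ / S.varE *
    (2 * S.yTildeE k γ₀ γ / √(S.yE k γ₀)
      - (S.yE k γ + S.varE) / (S.yE k γ₀ + S.varE) - 1)) +
  Real.logb 2 (S.varE / (S.varE + S.xE k γ₀ + S.yE k γ₀)) -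
  1 / Real.log 2 * ((S.xE k γ + S.yE k γ - S.xE k γ₀ - S.yE k γ₀) /
    (S.varE + S.xE k γ₀ + S.yE k γ₀))

/-- The objective of the surrogate problem built at `γ₀`. -/
def surrogateObjective (γ₀ γ : Fin N → ℂ) : ℝ :=
  (∑ k, S.rateSurrogate k γ₀ γ) / (S.risPower γ + S.Pceq)

/-- The feasible set of the surrogate problem built at `γ₀`. -/
def surrogateSet (γ₀ : Fin N → ℂ) : Set (Fin N → ℂ) :=
  {γ | quadForm S.R γ ≤ S.PRmax + S.trR ∧
    S.trR ≤ quadForm S.R γ₀ + 2 * (star γ₀ ⬝ᵥ (S.R *ᵥ (γ - γ₀))).re}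

/-- `γ` is a (global) solution of the surrogate problem built at `γ₀`. -/
def IsSurrogateSolution (γ₀ γ : Fin N → ℂ) : Prop :=
  γ ∈ S.surrogateSet γ₀ ∧ IsMaxOn (S.surrogateObjective γ₀) (S.surrogateSet γ₀) γ

/-- The iterates of the algorithm: start at any feasible vector and replace the current vector
by a solution of the surrogate problem built at it. (The stopping rule is not part of this
definition; the run is continued indefinitely.) -/
def IsRun (γ : ℕ → Fin N → ℂ) : Prop :=
  γ 0 ∈ S.feasibleSet ∧ ∀ t, S.IsSurrogateSolution (γ t) (γ (t + 1))

end RISNetwork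

end

/-! The algorithm is minorization-maximization. The surrogate objective lies below the objective
wherever the power denominator is positive and agrees with it at a base point
(`surrogateObjective_le`, `surrogateObjective_self`). The surrogate feasible set lies in the true
one, since a convex form dominates its linearization, and contains every feasible base point. So no
iteration lowers the objective. First derivatives agree automatically, because the difference has a
local minimum at the base point (`fderiv_surrogateObjective`).

The rate bound rests on a root-free inequality for `log (1 + x / y)` (`fracMinorant_le`), obtained
from `log t ≤ t - 1`, AM-GM and Cauchy-Schwarz. Clearing the roots also makes the surrogate
continuous jointly in base point and variable, even where a root vanishes.

All stationarity claims go through `isKKT_of_forall_le`. At an iterate without strict gain its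
hypothesis follows from maximality. At a limit point `z`, a vector strictly feasible for the
surrogate problem at `z` is feasible for the problems at nearby iterates, so its surrogate value is
at most `L`. Compactness gives the distance claim. Steps vanish because surrogate values are
squeezed between consecutive objective values, and equality in the bound forces the new vector to be
the base point when `ME` is positive definite. -/

section SurrogateTheory

open Filter Topology

/-! ### Hermitian forms as real quadratic forms -/

/-- The real bilinear form `Re (zᴴ M w)`. -/
noncomputable def realBilin {n : ℕ} (M : Matrix (Fin n) (Fin n) ℂ) (z w : Fin n → ℂ) : ℝ :=
  (star z ⬝ᵥ (M *ᵥ w)).re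

section RealBilin

open scoped ComplexOrder

variable {n : ℕ} (M M' : Matrix (Fin n) (Fin n) ℂ) (z w v : Fin n → ℂ)

theorem quadForm_eq_realBilin : quadForm M z = realBilin M z z := rfl

theorem realBilin_add_right : realBilin M z (w + v) = realBilin M z w + realBilin M z v := by
  simp [realBilin, Matrix.mulVec_add, dotProduct_add]

theorem realBilin_sub_right : realBilin M z (w - v) = realBilin M z w - realBilin M z v := by
  simp [realBilin, Matrix.mulVec_sub, dotProduct_sub]

theorem realBilin_add_left : realBilin M (w + v) z = realBilin M w z + realBilin M v z := by
  simp [realBilin, add_dotProduct]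

theorem realBilin_smul_right (s : ℝ) : realBilin M z (s • w) = s * realBilin M z w := by
  simp [realBilin, Matrix.mulVec_smul, dotProduct_smul]

theorem realBilin_smul_left (s : ℝ) : realBilin M (s • z) w = s * realBilin M z w := by
  simp [realBilin, smul_dotProduct]

variable {M} in
theorem realBilin_comm (hM : M.IsHermitian) : realBilin M z w = realBilin M w z := by
  have h : star (star z ⬝ᵥ (M *ᵥ w)) = star w ⬝ᵥ (M *ᵥ z) := by
    rw [← Matrix.star_dotProduct_star, star_star, Matrix.star_mulVec, hM.eq,
      Matrix.dotProduct_mulVec, dotProduct_comm]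
  unfold realBilin
  rw [← h]
  simp

variable {M} in
theorem quadForm_add_smul (hM : M.IsHermitian) (s : ℝ) :
    quadForm M (z + s • w) = quadForm M z + 2 * s * realBilin M z w + s ^ 2 * quadForm M w := by
  simp only [quadForm_eq_realBilin, realBilin_add_left, realBilin_add_right, realBilin_smul_left,
    realBilin_smul_right, realBilin_comm w z hM]
  ring

variable {M} in
theorem quadForm_sub (hM : M.IsHermitian) :
    quadForm M (w - z) = quadForm M w - 2 * realBilin M z w + quadForm M z := by
  have h := quadForm_add_smul w z hM (-1)
  rw [realBilin_comm w z hM] at h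
  have e : w - z = w + (-1 : ℝ) • z := by simp [sub_eq_add_neg]
  rw [e, h]; ring

variable {M} in
theorem quadForm_nonneg (hM : M.PosSemidef) : 0 ≤ quadForm M z := by
  have := hM.re_dotProduct_nonneg z
  simpa [quadForm] using this

variable {M} in
theorem quadForm_pos (hM : M.PosDef) {z : Fin n → ℂ} (hz : z ≠ 0) : 0 < quadForm M z := by
  have := hM.re_dotProduct_pos hz
  simpa [quadForm] using this

/-- Cauchy-Schwarz inequality for a positive semidefinite form. -/
theorem realBilin_sq_le {M : Matrix (Fin n) (Fin n) ℂ} (hM : M.PosSemidef) :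
    realBilin M z w ^ 2 ≤ quadForm M z * quadForm M w := by
  -- The form at `z + s • w` is a nonnegative quadratic polynomial in `s`, so its discriminant is at
  -- most zero.
  have h : ∀ s : ℝ, 0 ≤ quadForm M w * (s * s) + 2 * realBilin M z w * s + quadForm M z := by
    intro s
    have h1 := quadForm_nonneg (z + s • w) hM
    rw [quadForm_add_smul z w hM.isHermitian] at h1
    linarith
  have := discrim_le_zero h
  unfold discrim at this
  linarith

theorem realBilin_add_matrix : realBilin (M + M') z w = realBilin M z w + realBilin M' z w := by
  simp [realBilin, Matrix.add_mulVec, dotProduct_add]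

theorem quadForm_add_matrix : quadForm (M + M') z = quadForm M z + quadForm M' z :=
  realBilin_add_matrix M M' z z

theorem quadForm_smul_matrix (s : ℝ) : quadForm ((s : ℂ) • M) z = s * quadForm M z := by
  simp [quadForm, Matrix.smul_mulVec, dotProduct_smul]

theorem quadForm_sum_matrix {ι : Type*} (t : Finset ι) (F : ι → Matrix (Fin n) (Fin n) ℂ) :
    quadForm (∑ i ∈ t, F i) z = ∑ i ∈ t, quadForm (F i) z := by
  simp [quadForm, Matrix.sum_mulVec, dotProduct_sum]

theorem quadForm_diagonal (d : Fin n → ℝ) :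
    quadForm (Matrix.diagonal fun i => (d i : ℂ)) z = ∑ i, d i * ‖z i‖ ^ 2 := by
  simp only [quadForm, dotProduct, Matrix.mulVec_diagonal, Complex.re_sum]
  refine Finset.sum_congr rfl fun i _ => ?_
  rw [← Complex.normSq_eq_norm_sq, Complex.normSq_apply]
  simp
  ring

theorem quadForm_one : quadForm (1 : Matrix (Fin n) (Fin n) ℂ) z = ∑ i, ‖z i‖ ^ 2 := by
  have := quadForm_diagonal z (fun _ => 1)
  simpa using this

theorem quadForm_conjTranspose_mul_mul {m : ℕ} (B : Matrix (Fin n) (Fin m) ℂ)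
    (z : Fin m → ℂ) : quadForm (Bᴴ * M * B) z = quadForm M (B *ᵥ z) := by
  simp only [quadForm, Matrix.star_mulVec, ← Matrix.mulVec_mulVec, Matrix.dotProduct_mulVec,
    Matrix.vecMul_vecMul]

theorem quadForm_vecMulVec (u : Fin n → ℂ) :
    quadForm (Matrix.vecMulVec u (star u)) z = ‖star u ⬝ᵥ z‖ ^ 2 := by
  have h : star z ⬝ᵥ (Matrix.vecMulVec u (star u) *ᵥ z) = (star (star u ⬝ᵥ z)) * (star u ⬝ᵥ z) := by
    rw [Matrix.vecMulVec_mulVec, ← Matrix.star_dotProduct_star, star_star]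
    simp [dotProduct_smul, mul_comm, dotProduct_comm]
  rw [quadForm, h, ← Complex.normSq_eq_norm_sq, Complex.normSq_apply]
  simp

theorem differentiable_realBilin {E : Type*} [NormedAddCommGroup E] [NormedSpace ℝ E]
    {f g : E → Fin n → ℂ} (hf : Differentiable ℝ f) (hg : Differentiable ℝ g) :
    Differentiable ℝ fun x => realBilin M (f x) (g x) := by
  unfold realBilin
  simp only [dotProduct, Matrix.mulVec]
  refine Complex.reCLM.differentiable.comp ?_
  have hf' : ∀ i, Differentiable ℝ fun x => f x i := fun i => by fun_prop
  have hg' : ∀ i, Differentiable ℝ fun x => g x i := fun i => by fun_prop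
  refine Differentiable.fun_sum fun i _ => ?_
  refine Differentiable.mul ((hf' i).star) ?_
  exact Differentiable.fun_sum fun j _ => (hg' j).const_mul _

theorem differentiable_quadForm : Differentiable ℝ (quadForm M) :=
  differentiable_realBilin M differentiable_id differentiable_id

theorem continuous_quadForm : Continuous (quadForm M) := (differentiable_quadForm M).continuous

variable {M} in
theorem fderiv_quadForm (hM : M.IsHermitian) :
    fderiv ℝ (quadForm M) z w = 2 * realBilin M z w := by
  have h1 := (differentiable_quadForm M z).hasFDerivAt.hasLineDerivAt w
  have h2 : HasDerivAt (fun s : ℝ => quadForm M (z + s • w)) (2 * realBilin M z w) 0 := by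
    rw [funext fun s => quadForm_add_smul z w hM s]
    have a := ((hasDerivAt_id (0 : ℝ)).const_mul 2).mul_const (realBilin M z w)
    have b := ((hasDerivAt_id (0 : ℝ)).pow 2).mul_const (quadForm M w)
    have := (a.const_add (quadForm M z)).add b
    exact this.congr_deriv (by simp)
  exact HasDerivAt.unique h1 h2

end RealBilin

/-! ### The scalar lower bound for `log (1 + x / y)` -/

/-- The root-free form of the lower bound of `log (1 + x / y)` built at `(x₀, y₀)`, where `b`
stands for the lower bound of `√x₀ * √x`. -/
noncomputable def fracMinorant (x₀ y₀ b x y : ℝ) : ℝ :=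
  Real.log (1 + x₀ / y₀) + (2 * b / y₀ - x₀ / y₀ * ((x + y) / (x₀ + y₀)) - x₀ / y₀)

theorem fracMinorant_self {x y : ℝ} (hx : 0 ≤ x) (hy : 0 ≤ y) :
    fracMinorant x y x x y = Real.log (1 + x / y) := by
  unfold fracMinorant
  -- `y = 0` does occur, for a zero receive filter; division by zero then makes both sides `log 1`.
  rcases hy.eq_or_lt with rfl | hy
  · simp
  · field_simp
    ring

/-- The right side is `1 - t`, where `t` is the quotient of `1 + x₀ / y₀` by `1 + x / y`. The gap to
it is exactly an AM-GM defect divided by `y₀`. -/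
theorem log_frac_aux {x₀ y₀ b x y : ℝ} (hx₀ : 0 ≤ x₀) (hy₀ : 0 < y₀) (hx : 0 ≤ x) (hy : 0 < y)
    (hb : b ^ 2 ≤ x₀ * x) :
    2 * b / y₀ - x₀ / y₀ * ((x + y) / (x₀ + y₀)) - x₀ / y₀ ≤
      1 - ((x₀ + y₀) / y₀) * (y / (x + y)) := by
  have hs : 0 < x + y := by linarith
  have hs₀ : 0 < x₀ + y₀ := by linarith
  -- AM-GM: with `r = (x + y) / (x₀ + y₀)`, the sum `x₀ r + x / r` is at least `2 √(x₀ x)`, hence at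
  -- least `2 b`.
  have key : 2 * b ≤ x₀ * ((x + y) / (x₀ + y₀)) + x * ((x₀ + y₀) / (x + y)) := by
    apply le_of_sq_le_sq _ (by positivity)
    set r := (x + y) / (x₀ + y₀) with hr
    have hr' : (x₀ + y₀) / (x + y) = r⁻¹ := by rw [hr, inv_div]
    have hrp : r * r⁻¹ = 1 := mul_inv_cancel₀ (by positivity)
    rw [hr']
    have : (x₀ * r + x * r⁻¹) ^ 2 = (x₀ * r - x * r⁻¹) ^ 2 + 4 * (x₀ * x) * (r * r⁻¹) := by ring
    rw [this, hrp]
    nlinarith [sq_nonneg (x₀ * r - x * r⁻¹)]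
  have e : 1 - ((x₀ + y₀) / y₀) * (y / (x + y))
      - (2 * b / y₀ - x₀ / y₀ * ((x + y) / (x₀ + y₀)) - x₀ / y₀) =
      (x₀ * ((x + y) / (x₀ + y₀)) + x * ((x₀ + y₀) / (x + y)) - 2 * b) / y₀ := by
    field_simp
    ring
  have := div_nonneg (sub_nonneg.2 key) hy₀.le
  linarith

theorem log_frac_split {x₀ y₀ x y : ℝ} (hx₀ : 0 ≤ x₀) (hy₀ : 0 < y₀) (hx : 0 ≤ x) (hy : 0 < y) :
    Real.log (1 + x₀ / y₀) - Real.log (1 + x / y) =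
      Real.log (((x₀ + y₀) / y₀) * (y / (x + y))) := by
  have hs : 0 < x + y := by linarith
  have hs₀ : 0 < x₀ + y₀ := by linarith
  rw [← Real.log_div (by positivity) (by positivity)]
  congr 1
  field_simp
  ring

theorem fracMinorant_le {x₀ y₀ b x y : ℝ} (hx₀ : 0 ≤ x₀) (hy₀ : 0 < y₀) (hx : 0 ≤ x) (hy : 0 < y)
    (hb : b ^ 2 ≤ x₀ * x) : fracMinorant x₀ y₀ b x y ≤ Real.log (1 + x / y) := by
  have h1 := log_frac_aux hx₀ hy₀ hx hy hb
  have h2 := log_frac_split hx₀ hy₀ hx hy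
  have h3 := Real.log_le_sub_one_of_pos (x := ((x₀ + y₀) / y₀) * (y / (x + y))) (by positivity)
  unfold fracMinorant
  linarith

/-- If the lower bound with a common denominator is attained, then `x = x₀` and `x₀ ≤ b`. -/
theorem eq_of_fracMinorant_eq {x₀ y b x : ℝ} (hx₀ : 0 ≤ x₀) (hy : 0 < y) (hx : 0 ≤ x)
    (hb : b ^ 2 ≤ x₀ * x) (h : fracMinorant x₀ y b x y = Real.log (1 + x / y)) :
    x = x₀ ∧ b = x₀ := by
  have h1 := log_frac_aux hx₀ hy hx hy hb
  have h2 := log_frac_split hx₀ hy hx hy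
  have hs : 0 < x + y := by linarith
  have hs₀ : 0 < x₀ + y := by linarith
  -- With a common denominator the logarithm's argument is 1 only for `x = x₀`; otherwise `log t < t
  -- - 1` makes the bound strict.
  have hx' : x = x₀ := by
    by_contra hne
    have h3 := Real.log_lt_sub_one_of_pos (x := ((x₀ + y) / y) * (y / (x + y))) (by positivity)
      (by
        intro h
        field_simp at h
        exact hne (by linarith))
    unfold fracMinorant at h
    linarith
  refine ⟨hx', ?_⟩
  subst hx'
  unfold fracMinorant at h
  rw [div_self hs.ne'] at h
  field_simp at h
  linarith

/-! ### The network quantities and the minorant of the secrecy rate -/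

namespace RISNetwork

open scoped ComplexOrder

variable {N K NB : ℕ} (S : RISNetwork N K NB)

/-- The sign conditions on the data of the network. -/
structure IsAdmissible : Prop where
  p_nonneg : ∀ k, 0 ≤ S.p k
  μ_nonneg : ∀ k, 0 ≤ S.μ k
  varB_pos : 0 < S.varB
  varRIS_pos : 0 < S.varRIS
  varE_pos : 0 < S.varE
  varG_nonneg : 0 ≤ S.varG
  PRmax_pos : 0 < S.PRmax
  Pc_pos : 0 < S.Pc

theorem posSemidef_real_smul {n : ℕ} {M : Matrix (Fin n) (Fin n) ℂ} (hM : M.PosSemidef) {s : ℝ}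
    (hs : 0 ≤ s) : ((s : ℂ) • M).PosSemidef :=
  hM.smul (by exact_mod_cast hs)

theorem posDef_real_smul {n : ℕ} {M : Matrix (Fin n) (Fin n) ℂ} (hM : M.PosDef) {s : ℝ}
    (hs : 0 < s) : ((s : ℂ) • M).PosDef :=
  hM.smul (by exact_mod_cast hs)

theorem risPower_eq (γ : Fin N → ℂ) : S.risPower γ = quadForm S.R γ := by
  unfold risPower quadForm
  rw [Matrix.mul_vecMulVec, Matrix.trace_vecMulVec, dotProduct_comm]

theorem posSemidef_MB (k : Fin K) : (S.MB k).PosSemidef :=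
  (Matrix.posSemidef_vecMulVec_self_star _).conjTranspose_mul_mul_same _

theorem quadForm_MB (k : Fin K) (γ : Fin N → ℂ) :
    quadForm (S.MB k) γ = ‖star (S.c k) ⬝ᵥ (S.A k *ᵥ γ)‖ ^ 2 := by
  rw [MB, quadForm_conjTranspose_mul_mul, quadForm_vecMulVec]

theorem xB_eq (k : Fin K) (γ : Fin N → ℂ) : S.xB k γ = S.p k * quadForm (S.MB k) γ := by
  rw [xB, quadForm_MB]

theorem yE_eq (k : Fin K) (γ : Fin N → ℂ) : S.yE k γ = quadForm (S.ME k) γ := by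
  unfold yE ME
  rw [quadForm_add_matrix, quadForm_sum_matrix]
  simp only [quadForm_smul_matrix, quadForm_conjTranspose_mul_mul]

/-- The entries of `Γᴴ G_Bᴴ c` are `conj γ_n * u_n` with `u = G_Bᴴ c`, so the amplified noise,
quadratic in the filter, is also a diagonal form in `γ`. This identifies the SINR denominator with
`yB`. -/
theorem quadForm_W (c : Fin NB → ℂ) (γ : Fin N → ℂ) :
    quadForm (S.W γ) c = S.varB * ∑ j, ‖c j‖ ^ 2 +
      S.varRIS * ∑ n, ‖(S.GBᴴ *ᵥ c) n‖ ^ 2 * ‖γ n‖ ^ 2 := by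
  have e : S.GB * Matrix.diagonal γ * (Matrix.diagonal γ)ᴴ * S.GBᴴ =
      ((Matrix.diagonal γ)ᴴ * S.GBᴴ)ᴴ * (1 : Matrix (Fin N) (Fin N) ℂ) *
        ((Matrix.diagonal γ)ᴴ * S.GBᴴ) := by
    rw [Matrix.conjTranspose_mul, Matrix.conjTranspose_conjTranspose,
      Matrix.conjTranspose_conjTranspose, Matrix.mul_one, ← Matrix.mul_assoc]
  unfold W
  rw [quadForm_add_matrix, quadForm_smul_matrix, quadForm_smul_matrix, quadForm_one, e,
    quadForm_conjTranspose_mul_mul, quadForm_one]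
  congr 2
  refine Finset.sum_congr rfl fun n _ => ?_
  rw [← Matrix.mulVec_mulVec, Matrix.diagonal_conjTranspose, Matrix.mulVec_diagonal, norm_mul]
  simp
  ring

theorem sinrB_eq (k : Fin K) (γ : Fin N → ℂ) : S.sinrB k γ = S.xB k γ / S.yB k γ := by
  unfold sinrB xB yB U
  rw [quadForm_W, quadForm_diagonal]

theorem sinrE_eq (k : Fin K) (γ : Fin N → ℂ) :
    S.sinrE k γ = S.xE k γ / (S.yE k γ + S.varE) := rfl

theorem xB_eq_zero_of_c {k : Fin K} (hc : S.c k = 0) (γ : Fin N → ℂ) : S.xB k γ = 0 := by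
  simp [xB, hc]

theorem realBilin_MB_of_c {k : Fin K} (hc : S.c k = 0) (z w : Fin N → ℂ) :
    realBilin (S.MB k) z w = 0 := by
  simp [MB, hc, realBilin]

variable {S}

theorem IsAdmissible.posSemidef_RE (hS : S.IsAdmissible) : S.RE.PosSemidef :=
  (Matrix.posSemidef_vecMulVec_self_star _).add
    (posSemidef_real_smul Matrix.PosSemidef.one hS.varG_nonneg)

theorem IsAdmissible.posSemidef_ME_aux (hS : S.IsAdmissible) (k : Fin K) :
    (∑ m ∈ Finset.univ.erase k, (S.p m : ℂ) • ((S.H m)ᴴ * S.RE * S.H m)).PosSemidef :=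
  Matrix.posSemidef_sum _ fun m _ =>
    posSemidef_real_smul (hS.posSemidef_RE.conjTranspose_mul_mul_same _) (hS.p_nonneg m)

theorem IsAdmissible.posSemidef_ME (hS : S.IsAdmissible) (k : Fin K) : (S.ME k).PosSemidef :=
  (hS.posSemidef_ME_aux k).add (posSemidef_real_smul hS.posSemidef_RE hS.varRIS_pos.le)

theorem IsAdmissible.posDef_ME (hS : S.IsAdmissible) (hG : 0 < S.varG) (k : Fin K) :
    (S.ME k).PosDef :=
  Matrix.PosDef.posSemidef_add (hS.posSemidef_ME_aux k)
    (posDef_real_smul (Matrix.PosDef.posSemidef_add (Matrix.posSemidef_vecMulVec_self_star _)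
      (posDef_real_smul Matrix.PosDef.one hG)) hS.varRIS_pos)

theorem IsAdmissible.posSemidef_R_aux (hS : S.IsAdmissible) :
    (∑ k, (S.p k : ℂ) • ((S.H k)ᴴ * S.H k)).PosSemidef :=
  Matrix.posSemidef_sum _ fun m _ =>
    posSemidef_real_smul (Matrix.posSemidef_conjTranspose_mul_self _) (hS.p_nonneg m)

theorem IsAdmissible.posDef_R (hS : S.IsAdmissible) : S.R.PosDef :=
  Matrix.PosDef.posSemidef_add hS.posSemidef_R_aux
    (posDef_real_smul Matrix.PosDef.one hS.varRIS_pos)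

theorem IsAdmissible.varRIS_mul_norm_sq_le (hS : S.IsAdmissible) (γ : Fin N → ℂ) (n : Fin N) :
    S.varRIS * ‖γ n‖ ^ 2 ≤ quadForm S.R γ := by
  unfold R
  rw [quadForm_add_matrix, quadForm_smul_matrix, quadForm_one]
  have h1 := quadForm_nonneg γ hS.posSemidef_R_aux
  have h2 : ‖γ n‖ ^ 2 ≤ ∑ i, ‖γ i‖ ^ 2 :=
    Finset.single_le_sum (f := fun i => ‖γ i‖ ^ 2) (fun i _ => sq_nonneg _) (Finset.mem_univ n)
  have := mul_le_mul_of_nonneg_left h2 hS.varRIS_pos.le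
  linarith

theorem IsAdmissible.trR_nonneg (hS : S.IsAdmissible) : 0 ≤ S.trR :=
  (Complex.le_def.1 hS.posDef_R.posSemidef.trace_nonneg).1

theorem IsAdmissible.trR_pos (hS : S.IsAdmissible) [Nonempty (Fin N)] : 0 < S.trR :=
  (Complex.lt_def.1 hS.posDef_R.trace_pos).1

theorem IsAdmissible.xB_nonneg (hS : S.IsAdmissible) (k : Fin K) (γ : Fin N → ℂ) :
    0 ≤ S.xB k γ := mul_nonneg (hS.p_nonneg k) (sq_nonneg _)

theorem IsAdmissible.xE_nonneg (hS : S.IsAdmissible) (k : Fin K) (γ : Fin N → ℂ) :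
    0 ≤ S.xE k γ := mul_nonneg (hS.p_nonneg k) (quadForm_nonneg _ hS.posSemidef_RE)

theorem IsAdmissible.yE_nonneg (hS : S.IsAdmissible) (k : Fin K) (γ : Fin N → ℂ) :
    0 ≤ S.yE k γ := by
  rw [yE_eq]; exact quadForm_nonneg _ (hS.posSemidef_ME k)

theorem IsAdmissible.yB_ge (hS : S.IsAdmissible) (k : Fin K) (γ : Fin N → ℂ) :
    S.varB * ∑ j, ‖S.c k j‖ ^ 2 ≤ S.yB k γ := by
  unfold yB U
  rw [quadForm_diagonal]
  have h1 : 0 ≤ S.varRIS * ∑ n, ‖(S.GBᴴ *ᵥ S.c k) n‖ ^ 2 * ‖γ n‖ ^ 2 :=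
    mul_nonneg hS.varRIS_pos.le (Finset.sum_nonneg fun n _ => by positivity)
  have h2 : 0 ≤ ∑ m ∈ Finset.univ.erase k, S.p m * ‖star (S.c k) ⬝ᵥ (S.A m *ᵥ γ)‖ ^ 2 :=
    Finset.sum_nonneg fun m _ => mul_nonneg (hS.p_nonneg m) (sq_nonneg _)
  linarith

theorem IsAdmissible.yB_nonneg (hS : S.IsAdmissible) (k : Fin K) (γ : Fin N → ℂ) :
    0 ≤ S.yB k γ :=
  le_trans (mul_nonneg hS.varB_pos.le (Finset.sum_nonneg fun _ _ => sq_nonneg _)) (hS.yB_ge k γ)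

theorem IsAdmissible.yB_pos (hS : S.IsAdmissible) {k : Fin K} (hc : S.c k ≠ 0) (γ : Fin N → ℂ) :
    0 < S.yB k γ := by
  obtain ⟨j, hj⟩ := Function.ne_iff.1 hc
  have : 0 < ‖S.c k j‖ := norm_pos_iff.2 hj
  refine lt_of_lt_of_le (mul_pos hS.varB_pos ?_) (hS.yB_ge k γ)
  exact Finset.sum_pos' (fun _ _ => sq_nonneg _) ⟨j, Finset.mem_univ j, by positivity⟩

/-- The Taylor term of the surrogate, in root-free form. -/
theorem taylor_term_eq {M : Matrix (Fin N) (Fin N) ℂ} (hM : M.PosSemidef) {p : ℝ} (hp : 0 ≤ p)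
    (γ₀ γ : Fin N → ℂ) (y₀ C : ℝ) :
    p * quadForm M γ₀ / y₀ *
        (2 * (√p * sqrtTaylor M γ₀ γ) / √(p * quadForm M γ₀) - C - 1) =
      2 * (p * realBilin M γ₀ γ) / y₀ - p * quadForm M γ₀ / y₀ * C - p * quadForm M γ₀ / y₀ := by
  have hq := quadForm_nonneg γ₀ hM
  have hcs := realBilin_sq_le γ₀ γ hM
  rcases hp.eq_or_lt with rfl | hp
  · simp
  -- Where the root vanishes, the left side is zero, and Cauchy-Schwarz kills the bilinear term on
  -- the right.
  rcases hq.eq_or_lt with h0 | hq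
  · rw [← h0] at hcs ⊢
    have : realBilin M γ₀ γ = 0 := by
      have : realBilin M γ₀ γ ^ 2 = 0 := le_antisymm (by linarith) (sq_nonneg _)
      exact pow_eq_zero_iff (two_ne_zero) |>.1 this
    simp [this]
  -- The root of a quadratic form is homogeneous of degree one, so its Taylor expansion has no
  -- constant term.
  have e : sqrtTaylor M γ₀ γ = realBilin M γ₀ γ / √(quadForm M γ₀) := by
    unfold sqrtTaylor
    change _ + realBilin M γ₀ (γ - γ₀) / _ = _
    rw [realBilin_sub_right, ← quadForm_eq_realBilin]
    have := Real.sqrt_pos.2 hq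
    field_simp
    rw [Real.sq_sqrt hq.le]
    ring
  have hsp := Real.sqrt_pos.2 hp
  have hsq := Real.sqrt_pos.2 hq
  have e2 : 2 * (√p * sqrtTaylor M γ₀ γ) / √(p * quadForm M γ₀) =
      2 * realBilin M γ₀ γ / quadForm M γ₀ := by
    rw [e, Real.sqrt_mul hp.le, div_eq_div_iff (by positivity) hq.ne']
    field_simp
    rw [Real.sq_sqrt hq.le]
  rw [e2]
  field_simp

/-- The `k`-th secrecy rate (in nats). -/
noncomputable def rateNat (S : RISNetwork N K NB) (k : Fin K) (γ : Fin N → ℂ) : ℝ :=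
  Real.log (1 + S.xB k γ / S.yB k γ) + Real.log (1 + S.yE k γ / S.varE) +
    Real.log (S.varE / (S.varE + S.xE k γ + S.yE k γ))

/-- The root-free form of the surrogate of the `k`-th secrecy rate (in nats). -/
noncomputable def surrogateNat (S : RISNetwork N K NB) (k : Fin K) (γ₀ γ : Fin N → ℂ) : ℝ :=
  fracMinorant (S.xB k γ₀) (S.yB k γ₀) (S.p k * realBilin (S.MB k) γ₀ γ) (S.xB k γ) (S.yB k γ) +
  fracMinorant (S.yE k γ₀) S.varE (realBilin (S.ME k) γ₀ γ) (S.yE k γ) S.varE +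
  (Real.log (S.varE / (S.varE + S.xE k γ₀ + S.yE k γ₀)) -
    (S.xE k γ + S.yE k γ - S.xE k γ₀ - S.yE k γ₀) / (S.varE + S.xE k γ₀ + S.yE k γ₀))

theorem IsAdmissible.rate_eq (hS : S.IsAdmissible) (k : Fin K) (γ : Fin N → ℂ) :
    Real.logb 2 (1 + S.sinrB k γ) - Real.logb 2 (1 + S.sinrE k γ) = S.rateNat k γ / Real.log 2 := by
  have h1 := hS.xE_nonneg k γ
  have h2 := hS.yE_nonneg k γ
  have h3 := hS.varE_pos
  -- The eavesdropper's rate splits into a term with constant denominator, bounded like the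
  -- legitimate rate, and a term convex in the received power, bounded by its tangent.
  have e : Real.log (1 + S.xE k γ / (S.yE k γ + S.varE)) =
      - (Real.log (1 + S.yE k γ / S.varE) +
        Real.log (S.varE / (S.varE + S.xE k γ + S.yE k γ))) := by
    rw [← Real.log_mul (by positivity) (by positivity), ← Real.log_inv]
    congr 1
    field_simp
    ring
  rw [sinrB_eq, sinrE_eq, Real.logb, Real.logb, e, rateNat]
  ring

theorem IsAdmissible.rateSurrogate_eq (hS : S.IsAdmissible) (k : Fin K) (γ₀ γ : Fin N → ℂ) :
    S.rateSurrogate k γ₀ γ = S.surrogateNat k γ₀ γ / Real.log 2 := by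
  have h1 := taylor_term_eq (S.posSemidef_MB k) (hS.p_nonneg k) γ₀ γ (S.yB k γ₀)
    ((S.xB k γ + S.yB k γ) / (S.xB k γ₀ + S.yB k γ₀))
  have h2 := taylor_term_eq (hS.posSemidef_ME k) zero_le_one γ₀ γ S.varE
    ((S.yE k γ + S.varE) / (S.yE k γ₀ + S.varE))
  simp only [← xB_eq, one_mul, Real.sqrt_one, ← yE_eq] at h1 h2
  unfold rateSurrogate surrogateNat xTildeB yTildeE fracMinorant
  rw [h1, h2]
  simp only [Real.logb]
  ring

theorem IsAdmissible.surrogateNat_B_le (hS : S.IsAdmissible) (k : Fin K) (γ₀ γ : Fin N → ℂ) :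
    fracMinorant (S.xB k γ₀) (S.yB k γ₀) (S.p k * realBilin (S.MB k) γ₀ γ) (S.xB k γ) (S.yB k γ) ≤
      Real.log (1 + S.xB k γ / S.yB k γ) := by
  -- A zero filter gives no positive denominator, but then both sides are zero.
  by_cases hc : S.c k = 0
  · simp [fracMinorant, S.xB_eq_zero_of_c hc, S.realBilin_MB_of_c hc]
  · refine fracMinorant_le (hS.xB_nonneg _ _) (hS.yB_pos hc _) (hS.xB_nonneg _ _)
      (hS.yB_pos hc _) ?_
    have := mul_le_mul_of_nonneg_left (realBilin_sq_le γ₀ γ (S.posSemidef_MB k))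
      (sq_nonneg (S.p k))
    rw [xB_eq, xB_eq]
    linarith

theorem IsAdmissible.surrogateNat_E_sq_le (hS : S.IsAdmissible) (k : Fin K) (γ₀ γ : Fin N → ℂ) :
    realBilin (S.ME k) γ₀ γ ^ 2 ≤ S.yE k γ₀ * S.yE k γ := by
  rw [yE_eq, yE_eq]
  exact realBilin_sq_le γ₀ γ (hS.posSemidef_ME k)

theorem log_div_ge_tangent {σ a b : ℝ} (hσ : 0 < σ) (ha : 0 < a) (hb : 0 < b) :
    Real.log (σ / a) - (b - a) / a ≤ Real.log (σ / b) := by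
  have h := Real.log_le_sub_one_of_pos (div_pos hb ha)
  rw [Real.log_div hb.ne' ha.ne'] at h
  rw [Real.log_div hσ.ne' ha.ne', Real.log_div hσ.ne' hb.ne', sub_div, div_self ha.ne']
  linarith

theorem IsAdmissible.surrogateNat_tangent_le (hS : S.IsAdmissible) (k : Fin K)
    (γ₀ γ : Fin N → ℂ) :
    Real.log (S.varE / (S.varE + S.xE k γ₀ + S.yE k γ₀)) -
      (S.xE k γ + S.yE k γ - S.xE k γ₀ - S.yE k γ₀) / (S.varE + S.xE k γ₀ + S.yE k γ₀) ≤
    Real.log (S.varE / (S.varE + S.xE k γ + S.yE k γ)) := by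
  have h1 := hS.xE_nonneg k γ
  have h2 := hS.yE_nonneg k γ
  have h1' := hS.xE_nonneg k γ₀
  have h2' := hS.yE_nonneg k γ₀
  have h3 := hS.varE_pos
  have := log_div_ge_tangent (a := S.varE + S.xE k γ₀ + S.yE k γ₀)
    (b := S.varE + S.xE k γ + S.yE k γ) h3 (by positivity) (by positivity)
  refine le_trans (le_of_eq ?_) this
  congr 2
  ring

theorem IsAdmissible.surrogateNat_le (hS : S.IsAdmissible) (k : Fin K) (γ₀ γ : Fin N → ℂ) :
    S.surrogateNat k γ₀ γ ≤ S.rateNat k γ :=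
  add_le_add (add_le_add (hS.surrogateNat_B_le k γ₀ γ)
    (fracMinorant_le (hS.yE_nonneg _ _) hS.varE_pos (hS.yE_nonneg _ _) hS.varE_pos
      (hS.surrogateNat_E_sq_le k γ₀ γ))) (hS.surrogateNat_tangent_le k γ₀ γ)

theorem IsAdmissible.surrogateNat_self (hS : S.IsAdmissible) (k : Fin K) (γ : Fin N → ℂ) :
    S.surrogateNat k γ γ = S.rateNat k γ := by
  unfold surrogateNat rateNat
  rw [← quadForm_eq_realBilin, ← quadForm_eq_realBilin, ← xB_eq, ← yE_eq,
    fracMinorant_self (hS.xB_nonneg _ _) (hS.yB_nonneg _ _),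
    fracMinorant_self (hS.yE_nonneg _ _) hS.varE_pos.le]
  simp

/-- Equality in a sum of three bounds forces equality in each. The middle one gives equal `ME`-forms
and makes the bilinear term equal to them, so the `ME`-form of `γ - γ₀` is zero, and `0 < S.varG`
makes `ME` definite. -/
theorem IsAdmissible.eq_of_surrogateNat_eq (hS : S.IsAdmissible) (hG : 0 < S.varG) {k : Fin K}
    {γ₀ γ : Fin N → ℂ} (h : S.surrogateNat k γ₀ γ = S.rateNat k γ) : γ = γ₀ := by
  have h1 := hS.surrogateNat_B_le k γ₀ γ
  have h2 := fracMinorant_le (hS.yE_nonneg k γ₀) hS.varE_pos (hS.yE_nonneg k γ) hS.varE_pos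
      (hS.surrogateNat_E_sq_le k γ₀ γ)
  have h3 := hS.surrogateNat_tangent_le k γ₀ γ
  unfold surrogateNat rateNat at h
  obtain ⟨hy, hb⟩ := eq_of_fracMinorant_eq (hS.yE_nonneg k γ₀) hS.varE_pos (hS.yE_nonneg k γ)
    (hS.surrogateNat_E_sq_le k γ₀ γ) (by linarith)
  rw [yE_eq, yE_eq] at hy
  rw [yE_eq] at hb
  by_contra hne
  have := quadForm_pos (hS.posDef_ME hG k) (sub_ne_zero.2 hne)
  rw [quadForm_sub _ _ (hS.posDef_ME hG k).isHermitian] at this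
  linarith

end RISNetwork

/-! ### A multiplier rule for one active constraint, and calculus tools -/

/-- If `f` is nonpositive where `g` is negative, and `g` takes a negative value, then `f` is a
nonnegative multiple of `g`. -/
theorem exists_nonneg_smul_eq_of_nonpos {E : Type*} [NormedAddCommGroup E] [NormedSpace ℝ E]
    (f g : E →L[ℝ] ℝ) (h : ∀ d, g d < 0 → f d ≤ 0) {v : E} (hv : g v < 0) :
    ∃ l : ℝ, 0 ≤ l ∧ f = l • g := by
  -- A kernel vector moved slightly along `v` enters `g < 0`; the step is chosen so small that `f`
  -- would stay positive.
  have hker : ∀ d, g d = 0 → f d ≤ 0 := by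
    intro d hd
    by_contra! hpos
    obtain ⟨s, hs, hs'⟩ : ∃ s : ℝ, 0 < s ∧ 0 < f d + s * f v := by
      refine ⟨f d / (2 * (|f v| + 1)), by positivity, ?_⟩
      have h1 := neg_abs_le (f v)
      have h2 : 0 < f d / (2 * (|f v| + 1)) := by positivity
      have h3 : f d / (2 * (|f v| + 1)) * |f v| < f d := by
        rw [div_mul_eq_mul_div, div_lt_iff₀ (by positivity)]
        nlinarith [abs_nonneg (f v)]
      nlinarith
    have := h (d + s • v) (by simp [hd]; nlinarith)
    simp at this
    linarith
  refine ⟨f v / g v, div_nonneg_of_nonpos (h v hv) hv.le, ?_⟩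
  ext d
  have h1 : g (d - (g d / g v) • v) = 0 := by simp [hv.ne]
  have h2 := hker _ h1
  -- Using the opposite vector as well, `f` vanishes on the kernel of `g`, hence is proportional to
  -- `g`.
  have h3 := hker (-(d - (g d / g v) • v)) (by rw [map_neg, h1, neg_zero])
  rw [map_neg] at h3
  have h4 : f (d - (g d / g v) • v) = 0 := by linarith
  simp at h4
  have := hv.ne
  simp
  field_simp
  field_simp at h4
  linarith

theorem HasDerivAt.nonpos_of_eventually_le {f : ℝ → ℝ} {x f' : ℝ} (h : HasDerivAt f f' x)
    (hle : ∀ᶠ s in 𝓝[>] (0 : ℝ), f (x + s) ≤ f x) : f' ≤ 0 := by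
  refine le_of_tendsto h.tendsto_slope_zero_right ?_
  filter_upwards [hle, self_mem_nhdsWithin] with s hs hs0
  exact mul_nonpos_of_nonneg_of_nonpos (inv_nonneg.2 (le_of_lt hs0)) (by linarith)

theorem Differentiable.real_div {E : Type*} [NormedAddCommGroup E] [NormedSpace ℝ E] {f g : E → ℝ}
    (hf : Differentiable ℝ f) (hg : Differentiable ℝ g) (h : ∀ x, g x ≠ 0) :
    Differentiable ℝ fun x => f x / g x := fun x => by
  have h1 := hf x
  have h2 := hg x
  have h3 := h x
  fun_prop (disch := assumption)

theorem DifferentiableAt.real_div {E : Type*} [NormedAddCommGroup E] [NormedSpace ℝ E]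
    {f g : E → ℝ} {x : E} (hf : DifferentiableAt ℝ f x) (hg : DifferentiableAt ℝ g x)
    (h : g x ≠ 0) : DifferentiableAt ℝ (fun x => f x / g x) x := by
  fun_prop (disch := assumption)

/-! ### Smoothness and comparison of objective and surrogate -/

namespace RISNetwork

open scoped ComplexOrder

variable {N K NB : ℕ} {S : RISNetwork N K NB}

theorem differentiable_quadForm_mulVec {m : ℕ} (M : Matrix (Fin m) (Fin m) ℂ)
    (B : Matrix (Fin m) (Fin N) ℂ) : Differentiable ℝ fun γ : Fin N → ℂ => quadForm M (B *ᵥ γ) := by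
  simp only [← quadForm_conjTranspose_mul_mul]
  exact differentiable_quadForm _

theorem differentiable_norm_dotProduct_sq {m : ℕ} (c : Fin m → ℂ)
    (B : Matrix (Fin m) (Fin N) ℂ) :
    Differentiable ℝ fun γ : Fin N → ℂ => ‖star c ⬝ᵥ (B *ᵥ γ)‖ ^ 2 := by
  simp only [← quadForm_vecMulVec]
  exact differentiable_quadForm_mulVec _ _

variable (S)

theorem differentiable_xB (k : Fin K) : Differentiable ℝ (S.xB k) :=
  (differentiable_norm_dotProduct_sq _ _).const_mul _

theorem differentiable_yB (k : Fin K) : Differentiable ℝ (S.yB k) :=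
  (((differentiable_quadForm _).const_mul _).const_add _).add
    (Differentiable.fun_sum fun _ _ => (differentiable_norm_dotProduct_sq _ _).const_mul _)

theorem differentiable_xE (k : Fin K) : Differentiable ℝ (S.xE k) :=
  (differentiable_quadForm_mulVec _ _).const_mul _

theorem differentiable_yE (k : Fin K) : Differentiable ℝ (S.yE k) :=
  (Differentiable.fun_sum fun _ _ => (differentiable_quadForm_mulVec _ _).const_mul _).add
    ((differentiable_quadForm _).const_mul _)

theorem differentiable_risPower : Differentiable ℝ S.risPower := by
  rw [funext S.risPower_eq]; exact differentiable_quadForm _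

variable {S}

theorem IsAdmissible.differentiable_rateNat (hS : S.IsAdmissible) (k : Fin K) :
    Differentiable ℝ (S.rateNat k) := by
  have h1 := S.differentiable_xB k
  have h2 := S.differentiable_yB k
  have h3 := S.differentiable_xE k
  have h4 := S.differentiable_yE k
  have hE := hS.varE_pos
  refine Differentiable.add (Differentiable.add ?_ ?_) ?_
  · by_cases hc : S.c k = 0
    · simp only [S.xB_eq_zero_of_c hc]
      simp
    · refine Differentiable.log ((h1.real_div h2 fun γ => (hS.yB_pos hc γ).ne').const_add _) fun γ => ?_
      have := hS.xB_nonneg k γ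
      have := hS.yB_pos hc γ
      positivity
  · refine Differentiable.log ((h4.real_div (differentiable_const _) fun _ => hE.ne').const_add _) fun γ => ?_
    have := hS.yE_nonneg k γ
    positivity
  · have hpos : ∀ γ, 0 < S.varE + S.xE k γ + S.yE k γ := fun γ => by
      have := hS.yE_nonneg k γ
      have := hS.xE_nonneg k γ
      positivity
    exact Differentiable.log ((differentiable_const _).real_div ((h3.const_add _).add h4)
      fun γ => (hpos γ).ne') fun γ => (div_pos hE (hpos γ)).ne'

theorem differentiable_surrogateNat (k : Fin K) (γ₀ : Fin N → ℂ) :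
    Differentiable ℝ (S.surrogateNat k γ₀) := by
  have h1 := S.differentiable_xB k
  have h2 := S.differentiable_yB k
  have h3 := S.differentiable_xE k
  have h4 := S.differentiable_yE k
  have h5 : Differentiable ℝ (realBilin (S.MB k) γ₀) :=
    differentiable_realBilin _ (differentiable_const _) differentiable_id
  have h6 : Differentiable ℝ (realBilin (S.ME k) γ₀) :=
    differentiable_realBilin _ (differentiable_const _) differentiable_id
  unfold surrogateNat fracMinorant
  -- All divisors depend on `γ₀` only, so they are constants here and need not be nonzero.
  simp only [div_eq_mul_inv]
  fun_prop

theorem continuous_fracMinorant {X : Type*} [TopologicalSpace X] {x₀ y₀ b x y : X → ℝ}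
    (hx₀ : Continuous x₀) (hy₀ : Continuous y₀) (hb : Continuous b) (hx : Continuous x)
    (hy : Continuous y) (hx₀' : ∀ q, 0 ≤ x₀ q) (hy₀' : ∀ q, 0 < y₀ q) :
    Continuous fun q => fracMinorant (x₀ q) (y₀ q) (b q) (x q) (y q) := by
  have h1 : ∀ q, y₀ q ≠ 0 := fun q => (hy₀' q).ne'
  have h2 : ∀ q, x₀ q + y₀ q ≠ 0 := fun q => (add_pos_of_nonneg_of_pos (hx₀' q) (hy₀' q)).ne'
  have h3 : ∀ q, 1 + x₀ q / y₀ q ≠ 0 := fun q => by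
    have := div_nonneg (hx₀' q) (hy₀' q).le
    positivity
  unfold fracMinorant
  fun_prop (disch := assumption)

/-- Joint continuity is what the limit arguments need, since the base point moves along with the
iterates. -/
theorem IsAdmissible.continuous_surrogateNat (hS : S.IsAdmissible) (k : Fin K) :
    Continuous fun q : (Fin N → ℂ) × (Fin N → ℂ) => S.surrogateNat k q.1 q.2 := by
  have h1 := (S.differentiable_xB k).continuous
  have h2 := (S.differentiable_yB k).continuous
  have h3 := (S.differentiable_xE k).continuous
  have h4 := (S.differentiable_yE k).continuous
  have hb : ∀ M : Matrix (Fin N) (Fin N) ℂ,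
      Continuous fun q : (Fin N → ℂ) × (Fin N → ℂ) => realBilin M q.1 q.2 := fun M =>
    (differentiable_realBilin M differentiable_fst differentiable_snd).continuous
  have hE := hS.varE_pos
  refine Continuous.add (Continuous.add ?_ ?_) ?_
  · by_cases hc : S.c k = 0
    · simp only [fracMinorant, S.xB_eq_zero_of_c hc, S.realBilin_MB_of_c hc]
      simp [continuous_const]
    · exact continuous_fracMinorant (by fun_prop) (by fun_prop) ((hb _).const_mul _)
        (by fun_prop) (by fun_prop) (fun _ => hS.xB_nonneg _ _) (fun _ => hS.yB_pos hc _)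
  · exact continuous_fracMinorant (by fun_prop) (by fun_prop) (hb _)
        (by fun_prop) (by fun_prop) (fun _ => hS.yE_nonneg _ _) (fun _ => hE)
  · have hpos : ∀ γ, 0 < S.varE + S.xE k γ + S.yE k γ := fun γ => by
      have := hS.yE_nonneg k γ
      have := hS.xE_nonneg k γ
      positivity
    have h5 : ∀ q : (Fin N → ℂ) × (Fin N → ℂ), S.varE + S.xE k q.1 + S.yE k q.1 ≠ 0 :=
      fun q => (hpos _).ne'
    have h6 : ∀ q : (Fin N → ℂ) × (Fin N → ℂ),
        S.varE / (S.varE + S.xE k q.1 + S.yE k q.1) ≠ 0 :=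
      fun q => (div_pos hE (hpos _)).ne'
    fun_prop (disch := assumption)

theorem IsAdmissible.objective_eq (hS : S.IsAdmissible) :
    S.objective = fun γ => (∑ k, S.rateNat k γ / Real.log 2) / (S.risPower γ + S.Pceq) := by
  funext γ
  unfold objective
  simp only [hS.rate_eq]

theorem IsAdmissible.surrogateObjective_eq (hS : S.IsAdmissible) (γ₀ : Fin N → ℂ) :
    S.surrogateObjective γ₀ =
      fun γ => (∑ k, S.surrogateNat k γ₀ γ / Real.log 2) / (S.risPower γ + S.Pceq) := by
  funext γ
  unfold surrogateObjective
  simp only [hS.rateSurrogate_eq]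

/-- The lower power constraint offsets the `- trR` inside `Pceq`, leaving at least `Pc`. -/
theorem IsAdmissible.power_pos (hS : S.IsAdmissible) {γ : Fin N → ℂ} (h : γ ∈ S.feasibleSet) :
    0 < S.risPower γ + S.Pceq := by
  have h1 : 0 ≤ ∑ k, S.μ k * S.p k :=
    Finset.sum_nonneg fun k _ => mul_nonneg (hS.μ_nonneg k) (hS.p_nonneg k)
  have := h.1
  have := hS.Pc_pos
  unfold Pceq
  linarith

theorem IsAdmissible.differentiableAt_objective (hS : S.IsAdmissible) {γ : Fin N → ℂ}
    (h : γ ∈ S.feasibleSet) : DifferentiableAt ℝ S.objective γ := by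
  rw [hS.objective_eq]
  have hl := (Real.log_pos one_lt_two).ne'
  exact DifferentiableAt.real_div
    (DifferentiableAt.fun_sum fun k _ => (hS.differentiable_rateNat k γ).real_div
      (differentiableAt_const _) hl)
    ((S.differentiable_risPower γ).add_const _) (hS.power_pos h).ne'

theorem IsAdmissible.differentiableAt_surrogateObjective (hS : S.IsAdmissible) (γ₀ : Fin N → ℂ)
    {γ : Fin N → ℂ} (h : γ ∈ S.feasibleSet) : DifferentiableAt ℝ (S.surrogateObjective γ₀) γ := by
  rw [hS.surrogateObjective_eq]
  have hl := (Real.log_pos one_lt_two).ne'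
  exact DifferentiableAt.real_div
    (DifferentiableAt.fun_sum fun k _ => (differentiable_surrogateNat k γ₀ γ).real_div
      (differentiableAt_const _) hl)
    ((S.differentiable_risPower γ).add_const _) (hS.power_pos h).ne'

theorem IsAdmissible.continuousAt_surrogateObjective (hS : S.IsAdmissible) (γ₀ : Fin N → ℂ)
    {γ : Fin N → ℂ} (h : γ ∈ S.feasibleSet) :
    ContinuousAt (fun q : (Fin N → ℂ) × (Fin N → ℂ) => S.surrogateObjective q.1 q.2) (γ₀, γ) := by
  simp only [hS.surrogateObjective_eq]
  refine ContinuousAt.div ?_ ?_ (hS.power_pos h).ne'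
  · exact (continuous_finsetSum _ fun k _ =>
      (hS.continuous_surrogateNat k).div_const _).continuousAt
  · exact ((S.differentiable_risPower.continuous.comp continuous_snd).add_const _).continuousAt

theorem IsAdmissible.surrogateObjective_self (hS : S.IsAdmissible) (γ : Fin N → ℂ) :
    S.surrogateObjective γ γ = S.objective γ := by
  rw [hS.surrogateObjective_eq, hS.objective_eq]
  simp only [hS.surrogateNat_self]

theorem IsAdmissible.surrogateObjective_le (hS : S.IsAdmissible) (γ₀ : Fin N → ℂ)
    {γ : Fin N → ℂ} (h : 0 < S.risPower γ + S.Pceq) :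
    S.surrogateObjective γ₀ γ ≤ S.objective γ := by
  have := Real.log_pos one_lt_two
  rw [hS.surrogateObjective_eq, hS.objective_eq]
  dsimp only
  gcongr with k
  exact hS.surrogateNat_le k γ₀ γ

theorem IsAdmissible.eq_of_surrogateObjective_eq (hS : S.IsAdmissible) (hG : 0 < S.varG)
    (hK : 0 < K) {γ₀ γ : Fin N → ℂ} (hγ : γ ∈ S.feasibleSet)
    (h : S.surrogateObjective γ₀ γ = S.objective γ) : γ = γ₀ := by
  have hl := Real.log_pos one_lt_two
  rw [hS.surrogateObjective_eq, hS.objective_eq] at h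
  have h1 := (div_left_inj' (hS.power_pos hγ).ne').1 h
  have h2 := (Finset.sum_eq_sum_iff_of_le fun k _ =>
    div_le_div_of_nonneg_right (hS.surrogateNat_le k γ₀ γ) hl.le).1 h1 ⟨0, hK⟩ (Finset.mem_univ _)
  exact hS.eq_of_surrogateNat_eq hG ((div_left_inj' hl.ne').1 h2)

/-- Objective minus surrogate is nonnegative near `γ` and zero at `γ`, so its derivative vanishes
there; no gradient has to be computed. -/
theorem IsAdmissible.fderiv_surrogateObjective (hS : S.IsAdmissible) {γ : Fin N → ℂ}
    (h : γ ∈ S.feasibleSet) :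
    fderiv ℝ (S.surrogateObjective γ) γ = fderiv ℝ S.objective γ := by
  have hmin : IsLocalMin (fun x => S.objective x - S.surrogateObjective γ x) γ := by
    have h1 : ∀ᶠ x in 𝓝 γ, 0 < S.risPower x + S.Pceq :=
      ((S.differentiable_risPower.continuous.add_const _).continuousAt).eventually
        (lt_mem_nhds (hS.power_pos h))
    filter_upwards [h1] with x hx
    rw [hS.surrogateObjective_self, sub_self, sub_nonneg]
    exact hS.surrogateObjective_le γ hx
  have h0 := hmin.fderiv_eq_zero
  rw [fderiv_fun_sub (hS.differentiableAt_objective h)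
    (hS.differentiableAt_surrogateObjective γ h), sub_eq_zero] at h0
  exact h0.symm

/-! ### Surrogate constraints and the KKT criterion -/

theorem mem_surrogateSet_iff {γ₀ γ : Fin N → ℂ} : γ ∈ S.surrogateSet γ₀ ↔
    quadForm S.R γ ≤ S.PRmax + S.trR ∧
      S.trR ≤ quadForm S.R γ₀ + 2 * realBilin S.R γ₀ (γ - γ₀) := Iff.rfl

theorem mem_feasibleSet_iff {γ : Fin N → ℂ} : γ ∈ S.feasibleSet ↔
    S.trR ≤ quadForm S.R γ ∧ quadForm S.R γ ≤ S.PRmax + S.trR := by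
  rw [← risPower_eq]; rfl

/-- The form exceeds its linearization by the form of `γ - γ₀`, which is nonnegative. -/
theorem IsAdmissible.surrogateSet_subset (hS : S.IsAdmissible) (γ₀ : Fin N → ℂ) :
    S.surrogateSet γ₀ ⊆ S.feasibleSet := by
  intro γ hγ
  rw [mem_surrogateSet_iff] at hγ
  refine mem_feasibleSet_iff.2 ⟨hγ.2.trans ?_, hγ.1⟩
  have h1 := quadForm_nonneg (γ - γ₀) hS.posDef_R.posSemidef
  rw [quadForm_sub _ _ hS.posDef_R.isHermitian] at h1
  rw [realBilin_sub_right, ← quadForm_eq_realBilin]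
  linarith

theorem mem_surrogateSet_self {γ : Fin N → ℂ} (h : γ ∈ S.feasibleSet) :
    γ ∈ S.surrogateSet γ := by
  rw [mem_feasibleSet_iff] at h
  refine mem_surrogateSet_iff.2 ⟨h.2, ?_⟩
  rw [realBilin_sub_right]
  linarith [h.1]

variable (S) in
/-- The vectors that satisfy the constraints of the surrogate problem strictly. -/
def strictSurrogateSet (γ₀ : Fin N → ℂ) : Set (Fin N → ℂ) :=
  {γ | quadForm S.R γ < S.PRmax + S.trR ∧
    S.trR < quadForm S.R γ₀ + 2 * realBilin S.R γ₀ (γ - γ₀)}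

/-- An inactive constraint stays strict by continuity; an active one becomes strict through its
first-order change. -/
theorem IsAdmissible.eventually_mem_strictSurrogateSet (hS : S.IsAdmissible) {z d : Fin N → ℂ}
    (hz : z ∈ S.feasibleSet) (h1 : quadForm S.R z = S.trR → 0 < realBilin S.R z d)
    (h2 : quadForm S.R z = S.PRmax + S.trR → realBilin S.R z d < 0) :
    ∀ᶠ s in 𝓝[>] (0 : ℝ), z + s • d ∈ S.strictSurrogateSet z := by
  rw [mem_feasibleSet_iff] at hz
  have e1 : ∀ᶠ s in 𝓝[>] (0 : ℝ), quadForm S.R (z + s • d) < S.PRmax + S.trR := by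
    simp only [quadForm_add_smul z d hS.posDef_R.isHermitian]
    rcases hz.2.lt_or_eq with hlt | heq
    · have hc : ContinuousAt (fun s : ℝ => quadForm S.R z + 2 * s * realBilin S.R z d +
          s ^ 2 * quadForm S.R d) 0 := by fun_prop
      exact nhdsWithin_le_nhds (hc.eventually (gt_mem_nhds (by simpa using hlt)))
    · have hc : ContinuousAt (fun s : ℝ => 2 * realBilin S.R z d + s * quadForm S.R d) 0 := by
        fun_prop
      have : ∀ᶠ s in 𝓝 (0 : ℝ), 2 * realBilin S.R z d + s * quadForm S.R d < 0 :=
        hc.eventually (gt_mem_nhds (by linarith [h2 heq]))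
      filter_upwards [nhdsWithin_le_nhds this, self_mem_nhdsWithin] with s hs hs0
      have := mul_neg_of_pos_of_neg (Set.mem_Ioi.1 hs0) hs
      rw [heq]
      linarith
  have e2 : ∀ᶠ s in 𝓝[>] (0 : ℝ),
      S.trR < quadForm S.R z + 2 * realBilin S.R z ((z + s • d) - z) := by
    simp only [add_sub_cancel_left, realBilin_smul_right]
    rcases hz.1.lt_or_eq with hlt | heq
    · have hc : ContinuousAt (fun s : ℝ => quadForm S.R z + 2 * (s * realBilin S.R z d)) 0 := by
        fun_prop
      exact nhdsWithin_le_nhds (hc.eventually (lt_mem_nhds (by simpa using hlt)))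
    · filter_upwards [self_mem_nhdsWithin] with s hs0
      have := mul_pos (Set.mem_Ioi.1 hs0) (h1 heq.symm)
      linarith
  filter_upwards [e1, e2] with s a b using ⟨a, b⟩

theorem IsAdmissible.fderiv_objective_nonpos (hS : S.IsAdmissible) {z : Fin N → ℂ}
    (hz : z ∈ S.feasibleSet)
    (hmax : ∀ w ∈ S.strictSurrogateSet z, S.surrogateObjective z w ≤ S.objective z)
    {d : Fin N → ℂ} (h1 : quadForm S.R z = S.trR → 0 < realBilin S.R z d)
    (h2 : quadForm S.R z = S.PRmax + S.trR → realBilin S.R z d < 0) :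
    fderiv ℝ S.objective z d ≤ 0 := by
  rw [← hS.fderiv_surrogateObjective hz]
  have h := (hS.differentiableAt_surrogateObjective z hz).hasFDerivAt.hasLineDerivAt d
  refine HasDerivAt.nonpos_of_eventually_le h ?_
  filter_upwards [hS.eventually_mem_strictSurrogateSet hz h1 h2] with s hs
  simpa [hS.surrogateObjective_self] using hmax _ hs

theorem fderiv_constraint_zero (hR : S.R.IsHermitian) (z d : Fin N → ℂ) :
    fderiv ℝ (S.constraint 0) z d = - (2 * realBilin S.R z d) := by
  have e : S.constraint 0 = fun γ => S.trR - quadForm S.R γ := by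
    funext γ; simp [constraint, risPower_eq]
  rw [e, fderiv_const_sub, ← fderiv_quadForm z d hR]
  rfl

theorem fderiv_constraint_one (hR : S.R.IsHermitian) (z d : Fin N → ℂ) :
    fderiv ℝ (S.constraint 1) z d = 2 * realBilin S.R z d := by
  have e : S.constraint 1 = fun γ => quadForm S.R γ - (S.PRmax + S.trR) := by
    funext γ; simp [constraint, risPower_eq]
  rw [e, fderiv_sub_const, ← fderiv_quadForm z d hR]

/-- A feasible vector at which no strictly feasible vector of the surrogate problem improves the
surrogate objective is a KKT point. -/
theorem IsAdmissible.isKKT_of_forall_le (hS : S.IsAdmissible) {z : Fin N → ℂ}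
    (hz : z ∈ S.feasibleSet)
    (hmax : ∀ w ∈ S.strictSurrogateSet z, S.surrogateObjective z w ≤ S.objective z) :
    S.IsKKT z := by
  have hR := hS.posDef_R.isHermitian
  have hz' := mem_feasibleSet_iff.1 hz
  have hP := hS.PRmax_pos
  have c0 : S.constraint 0 z = S.trR - quadForm S.R z := by simp [constraint, risPower_eq]
  have c1 : S.constraint 1 z = quadForm S.R z - (S.PRmax + S.trR) := by
    simp [constraint, risPower_eq]
  refine ⟨hS.differentiableAt_objective hz, ?_, ?_, ?_⟩
  · rw [Fin.forall_fin_two]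
    exact ⟨(S.differentiable_risPower z).const_sub _, (S.differentiable_risPower z).sub_const _⟩
  · rw [Fin.forall_fin_two, c0, c1]
    exact ⟨by linarith [hz'.1], by linarith [hz'.2]⟩
  have hdir := fun d => hS.fderiv_objective_nonpos hz hmax (d := d)
  simp only [Fin.forall_fin_two, Fin.sum_univ_two, c0, c1]
  -- Since `PRmax` is positive, at most one constraint is active, so one multiplier suffices.
  by_cases hlow : quadForm S.R z = S.trR
  · have hne : quadForm S.R z ≠ S.PRmax + S.trR := by rw [hlow]; linarith
    rcases isEmpty_or_nonempty (Fin N) with hN | hN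
    -- For `N = 0` no direction increases the power, but all derivatives vanish.
    · exact ⟨0, by simp, by simp, by ext d; simp [Subsingleton.elim d 0]⟩
    -- Scaling up, direction `z`, strictly relaxes the lower constraint because `trR > 0`; below,
    -- `-z` does the same for the upper one.
    · obtain ⟨l, hl, hfl⟩ := exists_nonneg_smul_eq_of_nonpos (fderiv ℝ S.objective z)
        (fderiv ℝ (S.constraint 0) z)
        (fun d hd => hdir d (fun _ => by rw [fderiv_constraint_zero hR] at hd; linarith)
          fun h => absurd h hne) (v := z) (by
            rw [fderiv_constraint_zero hR, ← quadForm_eq_realBilin, hlow]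
            linarith [hS.trR_pos])
      exact ⟨![l, 0], by simp [hl], by simp [hlow], by simp [hfl]⟩
  by_cases hup : quadForm S.R z = S.PRmax + S.trR
  · obtain ⟨l, hl, hfl⟩ := exists_nonneg_smul_eq_of_nonpos (fderiv ℝ S.objective z)
      (fderiv ℝ (S.constraint 1) z)
      (fun d hd => hdir d (fun h => absurd h hlow) fun _ => by
        rw [fderiv_constraint_one hR] at hd; linarith) (v := (-1 : ℝ) • z) (by
          rw [fderiv_constraint_one hR, realBilin_smul_right, ← quadForm_eq_realBilin, hup]
          linarith [hS.trR_nonneg])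
    exact ⟨![0, l], by simp [hl], by simp [hup], by simp [hfl]⟩
  -- With no active constraint every direction and its opposite are admissible, so the derivative is
  -- zero.
  · refine ⟨0, by simp, by simp, ?_⟩
    ext d
    have h1 := hdir d (fun h => absurd h hlow) fun h => absurd h hup
    have h2 := hdir (-d) (fun h => absurd h hlow) fun h => absurd h hup
    rw [map_neg] at h2
    simp
    linarith

end RISNetwork

/-! ### Compactness, existence of solutions and convergence of runs -/

namespace RISNetwork

open scoped ComplexOrder

variable {N K NB : ℕ} {S : RISNetwork N K NB}

theorem IsAdmissible.isCompact_feasibleSet (hS : S.IsAdmissible) : IsCompact S.feasibleSet := by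
  have hc : Continuous (quadForm S.R) := continuous_quadForm _
  have e : S.feasibleSet =
      {γ | S.trR ≤ quadForm S.R γ} ∩ {γ | quadForm S.R γ ≤ S.PRmax + S.trR} := by
    ext γ; exact mem_feasibleSet_iff
  refine Metric.isCompact_of_isClosed_isBounded ?_ ?_
  · rw [e]
    exact (isClosed_le continuous_const hc).inter (isClosed_le hc continuous_const)
  -- The noise part `varRIS • 1` of `R` bounds every coordinate.
  · refine (Metric.isBounded_closedBall (x := (0 : Fin N → ℂ))
      (r := √((S.PRmax + S.trR) / S.varRIS))).subset fun γ hγ => ?_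
    rw [mem_closedBall_zero_iff]
    refine (pi_norm_le_iff_of_nonneg (Real.sqrt_nonneg _)).2 fun n => ?_
    refine Real.le_sqrt_of_sq_le ?_
    rw [le_div_iff₀ hS.varRIS_pos, mul_comm]
    exact (hS.varRIS_mul_norm_sq_le γ n).trans (mem_feasibleSet_iff.1 hγ).2

theorem IsAdmissible.isCompact_surrogateSet (hS : S.IsAdmissible) (γ₀ : Fin N → ℂ) :
    IsCompact (S.surrogateSet γ₀) := by
  refine hS.isCompact_feasibleSet.of_isClosed_subset ?_ (hS.surrogateSet_subset γ₀)
  have hc : Continuous (quadForm S.R) := continuous_quadForm _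
  have hb : Continuous fun γ => quadForm S.R γ₀ + 2 * realBilin S.R γ₀ (γ - γ₀) :=
    ((differentiable_realBilin S.R (differentiable_const γ₀)
      (differentiable_id.sub_const γ₀)).continuous.const_mul 2).const_add _
  exact (isClosed_le hc continuous_const).inter (isClosed_le continuous_const hb)

theorem IsAdmissible.exists_isSurrogateSolution (hS : S.IsAdmissible) {γ₀ : Fin N → ℂ}
    (h : γ₀ ∈ S.feasibleSet) : ∃ γ, S.IsSurrogateSolution γ₀ γ :=
  (hS.isCompact_surrogateSet γ₀).exists_isMaxOn ⟨γ₀, mem_surrogateSet_self h⟩ fun _ hγ =>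
    (hS.differentiableAt_surrogateObjective γ₀
      (hS.surrogateSet_subset γ₀ hγ)).continuousAt.continuousWithinAt

theorem continuous_realBilin_sub_left (M : Matrix (Fin N) (Fin N) ℂ) (w : Fin N → ℂ) :
    Continuous fun γ : Fin N → ℂ => quadForm M γ + 2 * realBilin M γ (w - γ) := by
  have h := (differentiable_realBilin M (f := fun γ : Fin N → ℂ => γ)
    (g := fun γ : Fin N → ℂ => w - γ) (by fun_prop) (by fun_prop)).continuous
  exact (continuous_quadForm M).add (h.const_mul 2)

section Solution

variable {γ₀ γ : Fin N → ℂ}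

theorem IsSurrogateSolution.mem_feasibleSet (h : S.IsSurrogateSolution γ₀ γ)
    (hS : S.IsAdmissible) : γ ∈ S.feasibleSet := hS.surrogateSet_subset γ₀ h.1

theorem IsSurrogateSolution.objective_le_surrogate (h : S.IsSurrogateSolution γ₀ γ)
    (hS : S.IsAdmissible) (h₀ : γ₀ ∈ S.feasibleSet) :
    S.objective γ₀ ≤ S.surrogateObjective γ₀ γ := by
  rw [← hS.surrogateObjective_self]
  exact h.2 (mem_surrogateSet_self h₀)

theorem IsSurrogateSolution.surrogate_le_objective (h : S.IsSurrogateSolution γ₀ γ)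
    (hS : S.IsAdmissible) : S.surrogateObjective γ₀ γ ≤ S.objective γ :=
  hS.surrogateObjective_le γ₀ (hS.power_pos (h.mem_feasibleSet hS))

/-- Without strict gain, the maximal surrogate value is at most the objective at `γ₀`, which is the
hypothesis of the KKT criterion. -/
theorem IsSurrogateSolution.objective_lt_or_isKKT (h : S.IsSurrogateSolution γ₀ γ)
    (hS : S.IsAdmissible) (h₀ : γ₀ ∈ S.feasibleSet) :
    S.objective γ₀ < S.objective γ ∨ S.IsKKT γ₀ := by
  refine or_iff_not_imp_left.2 fun hlt => hS.isKKT_of_forall_le h₀ fun w hw => ?_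
  have h1 : S.surrogateObjective γ₀ w ≤ S.surrogateObjective γ₀ γ := h.2 ⟨hw.1.le, hw.2.le⟩
  exact (h1.trans (h.surrogate_le_objective hS)).trans (not_lt.1 hlt)

end Solution

section Run

variable {γ : ℕ → Fin N → ℂ}

theorem IsRun.mem_feasibleSet (h : S.IsRun γ) (hS : S.IsAdmissible) : ∀ t, γ t ∈ S.feasibleSet
  | 0 => h.1
  | t + 1 => (h.2 t).mem_feasibleSet hS

theorem IsRun.monotone_objective (h : S.IsRun γ) (hS : S.IsAdmissible) :
    Monotone fun t => S.objective (γ t) :=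
  monotone_nat_of_le_succ fun t =>
    ((h.2 t).objective_le_surrogate hS (h.mem_feasibleSet hS t)).trans
      ((h.2 t).surrogate_le_objective hS)

theorem IsRun.exists_tendsto_objective (h : S.IsRun γ) (hS : S.IsAdmissible) :
    ∃ L, Tendsto (fun t => S.objective (γ t)) atTop (𝓝 L) := by
  obtain ⟨B, hB⟩ := hS.isCompact_feasibleSet.bddAbove_image (f := S.objective) fun z hz =>
    (hS.differentiableAt_objective hz).continuousAt.continuousWithinAt
  refine ⟨_, tendsto_atTop_ciSup (h.monotone_objective hS) ⟨B, ?_⟩⟩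
  rintro _ ⟨t, rfl⟩
  exact hB ⟨_, h.mem_feasibleSet hS t, rfl⟩

variable {L : ℝ} {z : Fin N → ℂ} {φ : ℕ → ℕ}

theorem IsRun.mem_feasibleSet_of_tendsto (h : S.IsRun γ) (hS : S.IsAdmissible)
    (hz : Tendsto (γ ∘ φ) atTop (𝓝 z)) : z ∈ S.feasibleSet :=
  hS.isCompact_feasibleSet.isClosed.mem_of_tendsto hz
    (Eventually.of_forall fun _ => h.mem_feasibleSet hS _)

theorem IsRun.objective_eq_of_tendsto (h : S.IsRun γ) (hS : S.IsAdmissible)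
    (hL : Tendsto (fun t => S.objective (γ t)) atTop (𝓝 L)) (hφ : Tendsto φ atTop atTop)
    (hz : Tendsto (γ ∘ φ) atTop (𝓝 z)) : S.objective z = L :=
  tendsto_nhds_unique
    ((hS.differentiableAt_objective (h.mem_feasibleSet_of_tendsto hS hz)).continuousAt.tendsto.comp
      hz) (hL.comp hφ)

/-- Only the base points need converge: a competitor's surrogate value at `γ (φ j)` is at most the
next objective value, hence at most `L`. -/
theorem IsRun.isKKT_of_tendsto (h : S.IsRun γ) (hS : S.IsAdmissible)
    (hL : Tendsto (fun t => S.objective (γ t)) atTop (𝓝 L)) (hφ : Tendsto φ atTop atTop)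
    (hz : Tendsto (γ ∘ φ) atTop (𝓝 z)) : S.IsKKT z := by
  have hzf := h.mem_feasibleSet_of_tendsto hS hz
  refine hS.isKKT_of_forall_le hzf fun w hw => ?_
  have hwf : w ∈ S.feasibleSet := hS.surrogateSet_subset z ⟨hw.1.le, hw.2.le⟩
  rw [h.objective_eq_of_tendsto hS hL hφ hz]
  have hpair : Tendsto (fun j => (γ (φ j), w)) atTop (𝓝 (z, w)) :=
    hz.prodMk_nhds tendsto_const_nhds
  have hlim := (hS.continuousAt_surrogateObjective z hwf).tendsto.comp hpair
  have hc := continuous_realBilin_sub_left S.R w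
  refine le_of_tendsto hlim ?_
  -- Strictness at `z` is what lets `w` stay feasible when the base point moves to a nearby iterate.
  have hev : ∀ᶠ j in atTop, S.trR <
      quadForm S.R (γ (φ j)) + 2 * realBilin S.R (γ (φ j)) (w - γ (φ j)) :=
    ((hc.tendsto z).comp hz).eventually (lt_mem_nhds hw.2)
  filter_upwards [hev] with j hj
  have hmem : w ∈ S.surrogateSet (γ (φ j)) := mem_surrogateSet_iff.2 ⟨hw.1.le, hj.le⟩
  have h1 := isMaxOn_iff.1 (h.2 (φ j)).2 w hmem
  have h2 := (h.2 (φ j)).surrogate_le_objective hS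
  have h3 : S.objective (γ (φ j + 1)) ≤ L :=
    (h.monotone_objective hS).ge_of_tendsto hL (φ j + 1)
  exact (h1.trans h2).trans h3

/-- Iterates staying away from these KKT points would, by compactness, accumulate at one of them. -/
theorem IsRun.eventually_dist_lt (h : S.IsRun γ) (hS : S.IsAdmissible)
    (hL : Tendsto (fun t => S.objective (γ t)) atTop (𝓝 L)) {δ : ℝ} (hδ : 0 < δ) :
    ∀ᶠ t in atTop, ∃ z, S.IsKKT z ∧ S.objective z = L ∧ dist (γ t) z < δ := by
  by_contra hcon
  obtain ⟨φ, hφ, hfar⟩ := extraction_of_frequently_atTop (not_eventually.1 hcon)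
  obtain ⟨z, -, ψ, hψ, hz⟩ := hS.isCompact_feasibleSet.tendsto_subseq fun j =>
    h.mem_feasibleSet hS (φ j)
  have hφψ := hφ.tendsto_atTop.comp hψ.tendsto_atTop
  obtain ⟨j, hj⟩ := (hz.eventually (Metric.ball_mem_nhds z hδ)).exists
  exact hfar (ψ j) ⟨z, h.isKKT_of_tendsto hS hL hφψ hz, h.objective_eq_of_tendsto hS hL hφψ hz, hj⟩

/-- If steps stayed large along a subsequence, the pairs of consecutive iterates would accumulate at
some `(z, w)`. Squeezing gives surrogate value `L` there, equal to the objective at `w`, so `w = z`,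
a contradiction. -/
theorem IsRun.tendsto_dist (h : S.IsRun γ) (hS : S.IsAdmissible)
    (hL : Tendsto (fun t => S.objective (γ t)) atTop (𝓝 L)) (hK : 0 < K) (hG : 0 < S.varG) :
    Tendsto (fun t => dist (γ (t + 1)) (γ t)) atTop (𝓝 0) := by
  rw [Metric.tendsto_atTop']
  by_contra! hcon
  obtain ⟨δ, hδ, hcon⟩ := hcon
  obtain ⟨φ, hφ, hfar⟩ := extraction_of_frequently_atTop
    (P := fun t => δ ≤ dist (γ (t + 1)) (γ t)) (frequently_atTop'.2 fun n => by
      obtain ⟨m, hm, hd⟩ := hcon n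
      exact ⟨m, hm, by simpa using hd⟩)
  obtain ⟨⟨z, w⟩, -, ψ, hψ, hzw⟩ :=
    (hS.isCompact_feasibleSet.prod hS.isCompact_feasibleSet).tendsto_subseq
      (x := fun j => (γ (φ j), γ (φ j + 1)))
      fun j => ⟨h.mem_feasibleSet hS (φ j), h.mem_feasibleSet hS (φ j + 1)⟩
  have hφψ := hφ.tendsto_atTop.comp hψ.tendsto_atTop
  have hφψ' : Tendsto (fun j => φ (ψ j) + 1) atTop atTop := (tendsto_add_atTop_nat 1).comp hφψ
  have hz : Tendsto (γ ∘ fun j => φ (ψ j)) atTop (𝓝 z) := hzw.fst_nhds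
  have hw : Tendsto (γ ∘ fun j => φ (ψ j) + 1) atTop (𝓝 w) := hzw.snd_nhds
  have hwf := h.mem_feasibleSet_of_tendsto hS hw
  have hsur : S.surrogateObjective z w = L := by
    refine tendsto_nhds_unique
      ((hS.continuousAt_surrogateObjective z hwf).tendsto.comp hzw) ?_
    exact tendsto_of_tendsto_of_tendsto_of_le_of_le (hL.comp hφψ) (hL.comp hφψ')
      (fun j => (h.2 _).objective_le_surrogate hS (h.mem_feasibleSet hS _))
      fun j => (h.2 _).surrogate_le_objective hS
  have hwz : w = z := hS.eq_of_surrogateObjective_eq hG hK hwf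
    (hsur.trans (h.objective_eq_of_tendsto hS hL hφψ' hw).symm)
  have hdist : Tendsto (fun j => dist (γ (φ (ψ j) + 1)) (γ (φ (ψ j)))) atTop (𝓝 (dist w z)) :=
    hw.dist hz
  have := ge_of_tendsto' hdist fun j => hfar (ψ j)
  rw [hwz, dist_self] at this
  linarith

end Run

end RISNetwork

end SurrogateTheory

theorem proposition4 {N K NB : ℕ} (S : RISNetwork N K NB)
    (hp : ∀ k, 0 ≤ S.p k) (hμ : ∀ k, 0 ≤ S.μ k)
    (hB : 0 < S.varB) (hRIS : 0 < S.varRIS) (hE : 0 < S.varE) (hG : 0 ≤ S.varG)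
    (hPR : 0 < S.PRmax) (hPc : 0 < S.Pc) :
    -- every iteration can be carried out, and leads to a feasible vector again
    (∀ γ₀ ∈ S.feasibleSet,
      (∃ γ, S.IsSurrogateSolution γ₀ γ) ∧
      ∀ γ, S.IsSurrogateSolution γ₀ γ → γ ∈ S.feasibleSet) ∧
    -- behaviour of an arbitrary run
    ∀ γ : ℕ → Fin N → ℂ, S.IsRun γ →
      -- monotone improvement, strict unless the current vector is a KKT point
      Monotone (fun t => S.objective (γ t)) ∧
      (∀ t, S.objective (γ t) < S.objective (γ (t + 1)) ∨ S.IsKKT (γ t)) ∧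
      -- the stopping rule is met after finitely many iterations
      (∀ ε > 0, ∃ t, |S.objective (γ (t + 1)) - S.objective (γ t)| < ε) ∧
      -- convergence
      (∃ L : ℝ, Filter.Tendsto (fun t => S.objective (γ t)) Filter.atTop (nhds L) ∧
        (∃ z, MapClusterPt z Filter.atTop γ) ∧
        (∀ z, MapClusterPt z Filter.atTop γ → S.IsKKT z ∧ S.objective z = L) ∧
        (∀ δ > 0, ∀ᶠ t in Filter.atTop,
          ∃ z, S.IsKKT z ∧ S.objective z = L ∧ dist (γ t) z < δ)) ∧
      (0 < K → 0 < S.varG →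
        Filter.Tendsto (fun t => dist (γ (t + 1)) (γ t)) Filter.atTop (nhds 0)) := by
  have hS : S.IsAdmissible := ⟨hp, hμ, hB, hRIS, hE, hG, hPR, hPc⟩
  refine ⟨fun γ₀ h₀ => ⟨hS.exists_isSurrogateSolution h₀, fun γ h => h.mem_feasibleSet hS⟩,
    fun γ h => ?_⟩
  obtain ⟨L, hL⟩ := h.exists_tendsto_objective hS
  refine ⟨h.monotone_objective hS,
    fun t => (h.2 t).objective_lt_or_isKKT hS (h.mem_feasibleSet hS t), fun ε hε => ?_,
    ⟨L, hL, ?_, fun z hz => ?_, fun δ hδ => h.eventually_dist_lt hS hL hδ⟩,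
    fun hK hG => h.tendsto_dist hS hL hK hG⟩
  -- Consecutive differences of a convergent sequence tend to zero.
  · have hd := ((hL.comp (Filter.tendsto_add_atTop_nat 1)).sub hL).abs
    rw [sub_self, abs_zero] at hd
    exact (hd.eventually (gt_mem_nhds hε)).exists
  · obtain ⟨z, -, φ, hφ, hz⟩ := hS.isCompact_feasibleSet.tendsto_subseq (h.mem_feasibleSet hS)
    exact ⟨z, hz.mapClusterPt.of_comp hφ.tendsto_atTop⟩
  · obtain ⟨φ, hφ, hz⟩ := hz.tendsto_subseq
    exact ⟨h.isKKT_of_tendsto hS hL hφ.tendsto_atTop hz,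
      h.objective_eq_of_tendsto hS hL hφ.tendsto_atTop hz⟩
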